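/- Let $\mathbf{k}$ be a field of characteristic zero, let $n\ge 1$, $e\ge 0$ be integers with $(n,e)\neq(1,0)$, let $m,d,r\ge 2$ be integers with $\gcd(d,r)=1$, and let $Q\in\mathbf{k}[X,S,T]$. Put $$B=\mathbf{k}[X,Y,Z,T]/\langle X^{n}Y-(Y^{m}-X^{e}Z)^{d}-T^{r}-X\,Q(X,Y^{m}-X^{e}Z,T)\rangle ,$$ let $x,y,z,t\in B$ be the classes of $X,Y,Z,T$, and let $s=y^{m}-x^{e}z$. A $\mathbf{k}$-derivation $\partial$ of a $\mathbf{k}$-algebra $A$ is locally nilpotent if for every $a\in A$ there is $N\ge 0$ with $\partial^{N}(a)=0$. The Derksen invariant $\mathcal{D}(A)$ is the $\mathbf{k}$-subalgebra of $A$ generated by the kernels of all nonzero locally nilpotent $\mathbf{k}$-derivations of $A$. Let $\omega$ be the weight degree function on $\mathbf{k}[X,Y,Z,S,T]$ with $\omega(X)=-1$, $\omega(Y)=n$, $\omega(Z)=nm+e$, $\omega(S)=\omega(T)=0$ and $\omega(0)=-\infty$, let $\pi:\mathbf{k}[X,Y,Z,S,T]\to B$ be the surjection $X,Y,Z,S,T\mapsto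 x,y,z,s,t$, and for $p\in B$ put $\omega_B(p)=\min\{\omega(P) : \pi(P)=p\}$. For a derivation $\partial$ of $B$, $\deg_{\omega_B}\partial$ denotes the smallest integer $\tau$ with $\partial(\mathcal{F}_i)\subseteq\mathcal{F}_{i+\tau}$ for all $i\in\mathbb{Z}$, where $\mathcal{F}_i=\{b\in B:\omega_B(b)\le i\}$. Theorem. (1) $B$ is an integral domain and $\mathcal{D}(B)=\mathbf{k}[x,s,t]$, the subalgebra of $B$ generated by $x,s,t$. In particular, $B$ is not isomorphic, as a $\mathbf{k}$-algebra, to the polynomial ring $\mathbf{k}^{[3]}$ in three variables. (2) The minimum defining $\omega_B$ is always attained and $\omega_B:B\to\mathbb{Z}\cup\{-\infty\}$ is a degree function: for all $a,b\in B$, $\omega_B(a)=-\infty$ if and only if $a=0$, $\omega_B(ab)=\omega_B(a)+\omega_B(b)$ and $\omega_B(a+b)\le\max\{\omega_B(a),\omega_B(b)\}$. For every nonzero locally nilpotent $\mathbf{k}$-derivation $\partial$ of $B$, the degree $\deg_{\omega_B}\partial$ exists and $\deg_{\omega_B}\partial\le -n-e$. -/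

import Mathlib

open MvPolynomial

namespace LND

section General

variable {k A : Type*} [CommRing k] [CommRing A] [Algebra k A]

/-- A `k`-derivation `D` of `A` is locally nilpotent if every element of `A` is killed by some
power of `D`. -/
def IsLocallyNilpotent (D : Derivation k A A) : Prop :=
  ∀ a : A, ∃ N : ℕ, (fun b => D b)^[N] a = 0

variable (k A) in
/-- The Derksen invariant: the `k`-subalgebra of `A` generated by the kernels of all nonzero
locally nilpotent `k`-derivations of `A`. -/
def derksenInvariant : Subalgebra k A :=
  Algebra.adjoin k {a : A | ∃ D : Derivation k A A, IsLocallyNilpotent D ∧ D ≠ 0 ∧ D a = 0}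

/-- A `ℤ`-degree function on a ring; `⊥` stands for `-∞`. -/
structure IsDegreeFunction (deg : A → WithBot ℤ) : Prop where
  eq_bot_iff : ∀ a, deg a = ⊥ ↔ a = 0
  map_mul : ∀ a b, deg (a * b) = deg a + deg b
  map_add_le : ∀ a b, deg (a + b) ≤ max (deg a) (deg b)

/-- The `i`-th member `{a | deg a ≤ i}` of the filtration of a degree function. -/
def filtration (deg : A → WithBot ℤ) (i : ℤ) : Set A := {a | deg a ≤ (i : WithBot ℤ)}

/-- `τ` is the degree of the derivation `D` with respect to the filtration of `deg`: the smallest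
integer with `D (F i) ⊆ F (i + τ)` for all `i`. -/
def HasDegree (deg : A → WithBot ℤ) (D : Derivation k A A) (τ : ℤ) : Prop :=
  IsLeast {σ : ℤ | ∀ i : ℤ, ∀ a ∈ filtration deg i, D a ∈ filtration deg (i + σ)} τ

end General

noncomputable section ClassB

variable {k : Type*} [Field k]

/-- The polynomial `X ^ n Y - (Y ^ m - X ^ e Z) ^ d - T ^ r - X Q(X, Y ^ m - X ^ e Z, T)`.
The variables `X, Y, Z, T` are numbered `0, 1, 2, 3`; those of `Q`, which are `X, S, T`, are
numbered `0, 1, 2`. -/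
def relation (n e m d r : ℕ) (Q : MvPolynomial (Fin 3) k) : MvPolynomial (Fin 4) k :=
  X 0 ^ n * X 1 - (X 1 ^ m - X 0 ^ e * X 2) ^ d - X 3 ^ r
    - X 0 * aeval ![X 0, X 1 ^ m - X 0 ^ e * X 2, X 3] Q

/-- The algebra `B`, the quotient of `k[X, Y, Z, T]` by the ideal generated by `relation`. -/
abbrev B (n e m d r : ℕ) (Q : MvPolynomial (Fin 3) k) : Type _ :=
  MvPolynomial (Fin 4) k ⧸ Ideal.span {relation n e m d r Q}

variable (n e m d r : ℕ) (Q : MvPolynomial (Fin 3) k)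

/-- The class of `X` in `B`. -/
def x : B n e m d r Q := Ideal.Quotient.mk _ (X 0)

/-- The class of `Y` in `B`. -/
def y : B n e m d r Q := Ideal.Quotient.mk _ (X 1)

/-- The class of `Z` in `B`. -/
def z : B n e m d r Q := Ideal.Quotient.mk _ (X 2)

/-- The class of `T` in `B`. -/
def t : B n e m d r Q := Ideal.Quotient.mk _ (X 3)

/-- The element `s = y ^ m - x ^ e z` of `B`. -/
def s : B n e m d r Q := y n e m d r Q ^ m - x n e m d r Q ^ e * z n e m d r Q

/-- The surjection from `k[X, Y, Z, S, T]` (variables numbered `0, 1, 2, 3, 4`) onto `B` that maps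
`X, Y, Z, S, T` to `x, y, z, s, t`. -/
def proj : MvPolynomial (Fin 5) k →ₐ[k] B n e m d r Q :=
  aeval ![x n e m d r Q, y n e m d r Q, z n e m d r Q, s n e m d r Q, t n e m d r Q]

/-- The weights `(-1, n, n m + e, 0, 0)` of `X, Y, Z, S, T`. -/
def weights : Fin 5 → ℤ := ![-1, n, n * m + e, 0, 0]

/-- The weight degrees of all polynomials in `k[X, Y, Z, S, T]` that represent `p`. -/
def liftDegrees (p : B n e m d r Q) : Set (WithBot ℤ) :=
  {w | ∃ P : MvPolynomial (Fin 5) k,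
    proj n e m d r Q P = p ∧ weightedTotalDegree' (weights n e m) P = w}

/-- The function `ω_B` on `B`: the least weight degree of a representative. The infimum of a
nonempty subset of `WithBot ℤ` always exists; that it is attained is part of the theorem. -/
def omegaB (p : B n e m d r Q) : WithBot ℤ := sInf (liftDegrees n e m d r Q p)

end ClassB

end LND

/-!
The algebra `B` is studied inside the ring of Laurent polynomials in `x, s, t`, where
`y = x ^ (-n) (f + x Q)` and `z = x ^ (-e) (y ^ m - s)`, with `f = s ^ d + t ^ r` (`emb`,
`emb_injective`). In particular `B` is a domain. An element of `B` of weight at most `w` has weight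
at most `w - 1` as soon as its homogeneous component of degree `w` in `x⁻¹` vanishes
(`mem_fil_sub_one`), so the function `omegaB` is the degree in `x⁻¹` (`omegaB_eq`), which is a
degree function. The leading forms of the elements of `B` make up the graded ring
`k[x, x ^ (-n) f, x ^ (-(n m + e)) f ^ m, s, t]`, whose second and third generators are again called
`y` and `z` here.

A derivation of `B` extends to the Laurent polynomials, as the derivation that multiplies the
monomial with exponent `g` by `φ g` for an additive map `φ` (`logDer_extHom_emb`). The leading part
of `φ` defines a homogeneous derivation `δ` of the graded ring, which is nonzero and locally
nilpotent if the given derivation is. The key fact is that `δ z ≠ 0` (`leading_grZ_ne_zero`). It has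
two consequences.
* A constant of positive degree would have a leading form a power of which is divisible by `z`. As
  kernels of locally nilpotent derivations are factorially closed, this would give `δ z = 0`. So all
  constants have degree at most `0`, that is, they lie in `k[x, s, t]`
  (`mem_fil_zero_of_map_eq_zero`, `fil_zero_le_algXST`).
* If the degree of the derivation were larger than `- n - e`, then `δ z` would be divisible by `z`,
  and a locally nilpotent derivation kills every element that divides its own derivative
  (`exists_hasDegree_le`).

To see that `δ z ≠ 0`, suppose that `δ z = 0`. Passing to the leading part for the weights `r` and
`d` of `s` and `t`, one may take `δ` to be bihomogeneous. Comparing degrees with respect to `δ` in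
the relations `x ^ n y = s ^ d + t ^ r` and `x ^ e z = y ^ m` shows that `δ` kills neither `s` nor
`t` (`map_eq_zero_of_relations`), and then that it kills no nonconstant quasi-homogeneous
polynomial in `s` and `t` (`eq_zero_of_map_qhPoly`). Hence every nonzero bihomogeneous constant has a power that
is a scalar multiple of a power of `z` (`exists_pow_eq_of_map_eq_zero`). This applies to the last
nonzero iterate `δ ^ N u` for every `u` in the span of `s ^ d` and `t ^ r`. Its bidegree determines
`N`, which is thus the same for all `u ≠ 0`, and its value at `x = s = t = 1` is not zero, because
that of `z` is not. But this value depends linearly on `u`, so it vanishes for some `u ≠ 0`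
(`eq_zero_of_bihomogeneous`).

Conversely, `x ^ (n + e) ∂/∂s` and `x ^ (n + e) ∂/∂t` are locally nilpotent derivations of `B` with
`x, t` and `x, s` among their constants (`exists_isLocallyNilpotent`). So the Derksen invariant is
`k[x, s, t]`. It does not contain `y`, which has degree `n > 0`, whereas the Derksen invariant of a
polynomial ring in three variables is the whole ring.
-/

namespace LND

/-! ### Elements on which a derivation acts nilpotently -/

section NilpotentElements

variable {k A : Type*} [CommRing k] [CommRing A] [Algebra k A]

theorem iterate_mul_eq_zero (E : Derivation k A A) (N : ℕ) : ∀ (p q : ℕ) (a b : A),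
    E^[p] a = 0 → E^[q] b = 0 → p + q ≤ N + 1 → E^[N] (a * b) = 0 := by
  induction N with
  | zero =>
    intro p q a b ha hb h
    obtain rfl | rfl : p = 0 ∨ q = 0 := by omega
    · simp_all
    · simp_all
  | succ N ih =>
    intro p q a b ha hb h
    rw [Function.iterate_succ_apply, E.leibniz, iterate_map_add, smul_eq_mul, smul_eq_mul]
    have h1 : E^[N] (a * E b) = 0 := by
      cases q with
      | zero => simp_all [iterate_map_zero]
      | succ q => exact ih p q _ _ ha hb (by omega)
    have h2 : E^[N] (b * E a) = 0 := by
      cases p with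
      | zero => simp_all [iterate_map_zero]
      | succ p => exact ih q p _ _ hb ha (by omega)
    rw [h1, h2, add_zero]

theorem iterate_map_smul (E : Derivation k A A) (N : ℕ) (c : k) (a : A) :
    E^[N] (c • a) = c • E^[N] a := by
  induction N with
  | zero => rfl
  | succ N ih => rw [Function.iterate_succ_apply', ih, E.map_smul, Function.iterate_succ_apply']

/-- The top term of the iterated Leibniz rule. -/
theorem iterate_mul_top (E : Derivation k A A) (N : ℕ) : ∀ (p q : ℕ) (a b : A),
    E^[p + 1] a = 0 → E^[q + 1] b = 0 → p + q = N →
    E^[N] (a * b) = (N.choose p : A) * (E^[p] a * E^[q] b) := by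
  induction N with
  | zero =>
    intro p q a b ha hb h
    obtain ⟨rfl, rfl⟩ : p = 0 ∧ q = 0 := by omega
    simp
  | succ N ih =>
    intro p q a b ha hb h
    rw [Function.iterate_succ_apply, E.leibniz, iterate_map_add, smul_eq_mul, smul_eq_mul]
    cases p with
    | zero =>
      obtain rfl : q = N + 1 := by omega
      have ha' : E a = 0 := ha
      rw [ih 0 N a (E b) ha hb (by omega), ha']
      simp [iterate_map_zero]
    | succ p =>
      cases q with
      | zero =>
        obtain rfl : p = N := by omega
        have hb' : E b = 0 := hb
        rw [ih 0 p b (E a) hb ha (by omega), hb']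
        simp [iterate_map_zero, mul_comm]
      | succ q =>
        rw [ih (p + 1) q a (E b) ha hb (by omega), ih (q + 1) p b (E a) hb ha (by omega)]
        have hs : N.choose (q + 1) = N.choose p := by
          rw [← Nat.choose_symm_of_eq_add (n := N) (a := p) (b := q + 1) (by omega)]
        rw [Nat.choose_succ_succ, hs]
        simp only [← Function.iterate_succ_apply]
        push_cast
        ring

/-- The subalgebra of the elements killed by some power of a derivation. -/
def nilSubalgebra (E : Derivation k A A) : Subalgebra k A where
  carrier := {a | ∃ N : ℕ, E^[N] a = 0}
  mul_mem' := by
    rintro a b ⟨p, hp⟩ ⟨q, hq⟩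
    exact ⟨p + q, iterate_mul_eq_zero E _ p q a b hp hq (by omega)⟩
  add_mem' := by
    rintro a b ⟨p, hp⟩ ⟨q, hq⟩
    refine ⟨p + q, ?_⟩
    rw [iterate_map_add]
    nth_rewrite 1 [add_comm p q]
    rw [Function.iterate_add_apply, Function.iterate_add_apply, hp, hq, iterate_map_zero,
      iterate_map_zero, add_zero]
  algebraMap_mem' c := ⟨1, by simp⟩

variable {E : Derivation k A A}

theorem mem_nilSubalgebra_of_map_eq_zero {a : A} (h : E a = 0) : a ∈ nilSubalgebra E :=
  ⟨1, h⟩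

theorem map_mem_nilSubalgebra {a : A} (h : a ∈ nilSubalgebra E) : E a ∈ nilSubalgebra E := by
  obtain ⟨N, hN⟩ := h
  refine ⟨N, ?_⟩
  rw [← Function.iterate_succ_apply, Function.iterate_succ_apply', hN, map_zero]

theorem mem_nilSubalgebra_of_map_mem {a : A} (h : E a ∈ nilSubalgebra E) :
    a ∈ nilSubalgebra E := by
  obtain ⟨N, hN⟩ := h
  exact ⟨N + 1, by rwa [Function.iterate_succ_apply]⟩

/-- The largest `N` with `E ^ N a ≠ 0`; it is meaningful for nonzero elements of
`nilSubalgebra E`. -/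
noncomputable def nilDegree (E : Derivation k A A) (a : A) : ℕ := sInf {N | E^[N + 1] a = 0}

theorem iterate_nilDegree_succ {a : A} (h : a ∈ nilSubalgebra E) :
    E^[nilDegree E a + 1] a = 0 := by
  obtain ⟨N, hN⟩ := h
  have : {N | E^[N + 1] a = 0}.Nonempty :=
    ⟨N, by rw [Set.mem_ofPred_eq, Function.iterate_succ_apply', hN, map_zero]⟩
  exact Nat.sInf_mem this

theorem iterate_eq_zero_of_nilDegree_lt {a : A} (h : a ∈ nilSubalgebra E) {N : ℕ}
    (hN : nilDegree E a < N) : E^[N] a = 0 := by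
  obtain ⟨j, rfl⟩ := Nat.exists_eq_add_of_lt hN
  rw [show nilDegree E a + j + 1 = j + (nilDegree E a + 1) by omega, Function.iterate_add_apply,
    iterate_nilDegree_succ h, iterate_map_zero]

theorem iterate_nilDegree_ne_zero {a : A} (ha : a ≠ 0) : E^[nilDegree E a] a ≠ 0 := by
  intro h
  rcases hN : nilDegree E a with _ | N
  · rw [hN] at h; exact ha h
  · rw [hN] at h
    have : nilDegree E a ≤ N := Nat.sInf_le h
    omega

theorem nilDegree_eq_of {a : A} (h : a ∈ nilSubalgebra E) {N : ℕ} (h0 : E^[N] a ≠ 0)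
    (h1 : E^[N + 1] a = 0) : nilDegree E a = N := by
  apply le_antisymm (Nat.sInf_le h1)
  by_contra! hlt
  exact h0 (iterate_eq_zero_of_nilDegree_lt h hlt)

theorem map_iterate_nilDegree {a : A} (h : a ∈ nilSubalgebra E) :
    E (E^[nilDegree E a] a) = 0 := by
  rw [← Function.iterate_succ_apply' E]; exact iterate_nilDegree_succ h

theorem nilDegree_eq_zero_of_map_eq_zero {a : A} (h : E a = 0) : nilDegree E a = 0 :=
  Nat.sInf_eq_zero.2 (Or.inl h)

theorem map_eq_zero_of_nilDegree {a : A} (h : a ∈ nilSubalgebra E) (h0 : nilDegree E a = 0) :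
    E a = 0 := by
  have := iterate_nilDegree_succ h
  rwa [h0] at this

theorem nilDegree_map {a : A} (h : a ∈ nilSubalgebra E) (h0 : E a ≠ 0) :
    nilDegree E (E a) + 1 = nilDegree E a := by
  have ha : a ≠ 0 := by rintro rfl; simp at h0
  refine (nilDegree_eq_of h ?_ ?_).symm
  · rw [Function.iterate_succ_apply]; exact iterate_nilDegree_ne_zero h0
  · rw [Function.iterate_succ_apply]; exact iterate_nilDegree_succ (map_mem_nilSubalgebra h)

variable [IsDomain A] [CharZero A]

theorem nilDegree_mul {a b : A} (ha : a ∈ nilSubalgebra E) (hb : b ∈ nilSubalgebra E)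
    (ha0 : a ≠ 0) (hb0 : b ≠ 0) : nilDegree E (a * b) = nilDegree E a + nilDegree E b := by
  refine nilDegree_eq_of (mul_mem ha hb) ?_ ?_
  · rw [iterate_mul_top E _ _ _ a b (iterate_nilDegree_succ ha) (iterate_nilDegree_succ hb) rfl]
    refine mul_ne_zero ?_ (mul_ne_zero (iterate_nilDegree_ne_zero ha0)
      (iterate_nilDegree_ne_zero hb0))
    exact_mod_cast (Nat.choose_pos (Nat.le_add_right _ _)).ne'
  · exact iterate_mul_eq_zero E _ _ _ a b (iterate_nilDegree_succ ha)
      (iterate_nilDegree_succ hb) (by omega)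

theorem nilDegree_pow {a : A} (ha : a ∈ nilSubalgebra E) (ha0 : a ≠ 0) (N : ℕ) :
    nilDegree E (a ^ N) = N * nilDegree E a := by
  induction N with
  | zero => simpa using nilDegree_eq_zero_of_map_eq_zero (E.map_one_eq_zero)
  | succ N ih => rw [pow_succ, nilDegree_mul (pow_mem ha N) ha (pow_ne_zero _ ha0) ha0, ih]; ring

/-- The kernel of a locally nilpotent derivation is factorially closed. -/
theorem map_eq_zero_of_mul {a b : A} (ha : a ∈ nilSubalgebra E) (hb : b ∈ nilSubalgebra E)
    (h0 : a * b ≠ 0) (h : E (a * b) = 0) : E a = 0 := by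
  have := nilDegree_mul ha hb (left_ne_zero_of_mul h0) (right_ne_zero_of_mul h0)
  rw [nilDegree_eq_zero_of_map_eq_zero h] at this
  exact map_eq_zero_of_nilDegree ha (by omega)

theorem map_eq_zero_of_pow {a : A} (ha : a ∈ nilSubalgebra E) {N : ℕ} (hN : N ≠ 0)
    (h : E (a ^ N) = 0) : E a = 0 := by
  by_cases ha0 : a = 0
  · simp [ha0]
  have := nilDegree_pow ha ha0 N
  rw [nilDegree_eq_zero_of_map_eq_zero h] at this
  exact map_eq_zero_of_nilDegree ha (by simpa [hN] using this.symm)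

/-- A locally nilpotent derivation kills every element that divides its own derivative. -/
theorem map_eq_zero_of_dvd {a b : A} (ha : a ∈ nilSubalgebra E) (hb : b ∈ nilSubalgebra E)
    (h : E a = a * b) : E a = 0 := by
  by_contra h0
  have h1 := nilDegree_map ha h0
  have h2 : a * b ≠ 0 := h ▸ h0
  rw [h, nilDegree_mul ha hb (left_ne_zero_of_mul h2) (right_ne_zero_of_mul h2)] at h1
  omega

end NilpotentElements

/-! ### Two criteria for a locally nilpotent derivation to vanish -/

section Relations

variable {k A : Type*} [CommRing k] [CommRing A] [Algebra k A] {E : Derivation k A A}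

theorem mul_map_pow (E : Derivation k A A) (a : A) (N : ℕ) :
    a * E (a ^ N) = N * a ^ N * E a := by
  rw [E.leibniz_pow]
  cases N with
  | zero => simp
  | succ N => simp [pow_succ]; ring

variable [IsDomain A] [CharZero A]

theorem nilDegree_lt_of_dvd {a b q v : A} (hv : v ≠ 0) (hEv : E v = 0)
    (ha : a ∈ nilSubalgebra E) (hb : b ∈ nilSubalgebra E) (hq : q ∈ nilSubalgebra E)
    (h0 : E a ≠ 0) (h : v * E a = b * q) : nilDegree E b < nilDegree E a := by
  have h1 := nilDegree_map ha h0
  have h2 : b * q ≠ 0 := h ▸ mul_ne_zero hv h0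
  have h3 := nilDegree_mul hb hq (left_ne_zero_of_mul h2) (right_ne_zero_of_mul h2)
  rw [← h, nilDegree_mul (mem_nilSubalgebra_of_map_eq_zero hEv) (map_mem_nilSubalgebra ha) hv h0,
    nilDegree_eq_zero_of_map_eq_zero hEv] at h3
  omega

/-- If `h` is a constant of `E` whose partial derivatives with respect to `s` and `t` are divisible
by `s ^ (d - 1)` and `t ^ (r - 1)`, then the degrees of `s` and `t` would each exceed the other
unless `E` kills one of them. The hypotheses `hEuler` and `hE` are Euler's identity for a
quasi-homogeneous `h` and the chain rule for `E h = 0`. -/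
theorem map_eq_zero_of_quasiHomogeneous {d r : ℕ} (hd : 2 ≤ d) (hr : 2 ≤ r) {s t h a b : A}
    (hs : s ∈ nilSubalgebra E) (ht : t ∈ nilSubalgebra E) (ha : a ∈ nilSubalgebra E)
    (hb : b ∈ nilSubalgebra E) (hs0 : s ≠ 0) (ht0 : t ≠ 0) (h0 : h ≠ 0) (hEh : E h = 0)
    (hEuler : h = r * s ^ d * a + d * t ^ r * b)
    (hE : s ^ (d - 1) * a * E s + t ^ (r - 1) * b * E t = 0) : E s = 0 ∨ E t = 0 := by
  obtain ⟨d, rfl⟩ := Nat.exists_eq_add_of_le' hd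
  obtain ⟨r, rfl⟩ := Nat.exists_eq_add_of_le' hr
  simp only [Nat.add_succ_sub_one] at hE
  by_contra! hcon
  have hEs := map_mem_nilSubalgebra hs
  have hEt := map_mem_nilSubalgebra ht
  have e1 : h * E t = s ^ (d + 1) * (a * (((r + 2 : ℕ) : A) * (s * E t) -
      ((d + 2 : ℕ) : A) * (t * E s))) := by
    rw [hEuler]
    linear_combination ((d + 2 : ℕ) : A) * t * hE
  have e2 : h * E s = t ^ (r + 1) * (b * (((d + 2 : ℕ) : A) * (t * E s) -
      ((r + 2 : ℕ) : A) * (s * E t))) := by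
    rw [hEuler]
    linear_combination ((r + 2 : ℕ) : A) * s * hE
  have hmem (i j : ℕ) : (i : A) * (s * E t) - (j : A) * (t * E s) ∈ nilSubalgebra E :=
    sub_mem (mul_mem (natCast_mem _ _) (mul_mem hs hEt))
      (mul_mem (natCast_mem _ _) (mul_mem ht hEs))
  have hmem' (i j : ℕ) : (i : A) * (t * E s) - (j : A) * (s * E t) ∈ nilSubalgebra E :=
    sub_mem (mul_mem (natCast_mem _ _) (mul_mem ht hEs))
      (mul_mem (natCast_mem _ _) (mul_mem hs hEt))
  have l1 := nilDegree_lt_of_dvd h0 hEh ht (pow_mem hs _) (mul_mem ha (hmem _ _)) hcon.2 e1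
  have l2 := nilDegree_lt_of_dvd h0 hEh hs (pow_mem ht _) (mul_mem hb (hmem' _ _)) hcon.1 e2
  rw [nilDegree_pow hs hs0] at l1
  rw [nilDegree_pow ht ht0] at l2
  nlinarith [Nat.zero_le (d * nilDegree E s), Nat.zero_le (r * nilDegree E t)]

/-- In a domain with elements `x ^ n y = u + t ^ r` and `x ^ e z = y ^ m`, a locally nilpotent
derivation that kills `u` and `z` also kills `x` and `t`. If not, the degree of `t` would be
both smaller than that of `x` (and of `y` if `e ≠ 0`) and larger than `n - 1` times the degree of
`x` plus the degree of `y`. -/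
theorem map_eq_zero_of_relations {n e m r : ℕ} (hn : 1 ≤ n) (hne : (n, e) ≠ (1, 0))
    (hm : 1 ≤ m) (hr : 2 ≤ r) {x y z u t : A} (hx : x ∈ nilSubalgebra E)
    (hy : y ∈ nilSubalgebra E) (ht : t ∈ nilSubalgebra E) (hx0 : x ≠ 0) (hy0 : y ≠ 0)
    (hu0 : u ≠ 0) (ht0 : t ≠ 0) (hz : E z = 0) (hu : E u = 0)
    (h1 : x ^ n * y = u + t ^ r) (h2 : x ^ e * z = y ^ m) : E x = 0 ∧ E t = 0 := by
  obtain ⟨n, rfl⟩ := Nat.exists_eq_add_of_le' hn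
  obtain ⟨r, rfl⟩ := Nat.exists_eq_add_of_le' hr
  have hEx := map_mem_nilSubalgebra hx
  have hEt := map_mem_nilSubalgebra ht
  have hEy := map_mem_nilSubalgebra hy
  have hR1 : (e : A) * y * E x = m * x * E y := by
    have a1 := congrArg (fun w => x * y * E w) h2
    simp only [E.leibniz, hz, smul_eq_mul, mul_zero, zero_add] at a1
    refine mul_left_cancel₀ (pow_ne_zero m hy0) ?_
    linear_combination a1 + x * mul_map_pow E y m - y * z * mul_map_pow E x e -
      e * y * E x * h2
  have hR2 : ((r + 2 : ℕ) : A) * t ^ (r + 1) * E t = x ^ (n + 1) * E y +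
      ((n + 1 : ℕ) : A) * x ^ n * y * E x := by
    have a1 := congrArg E h1
    simp only [E.leibniz, E.leibniz_pow, map_add, hu, smul_eq_mul, nsmul_eq_mul,
      Nat.add_succ_sub_one, zero_add] at a1
    linear_combination - a1
  set c : A := ((e + (n + 1) * m : ℕ) : A) with hc
  have hc0 : c ≠ 0 := by
    rw [hc]; exact_mod_cast (by positivity : 0 < e + (n + 1) * m).ne'
  have hm0 : (m : A) ≠ 0 := Nat.cast_ne_zero.2 (by omega)
  have hr0 : ((r + 2 : ℕ) : A) ≠ 0 := Nat.cast_ne_zero.2 (by omega)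
  have hEc : E c = 0 := E.map_natCast _
  have hR3 : (m : A) * ((r + 2 : ℕ) : A) * t ^ (r + 1) * E t = c * x ^ n * y * E x := by
    rw [hc]; push_cast at hR2 ⊢
    linear_combination m * hR2 - x ^ n * hR1
  have hkey : E t = 0 → E x = 0 := by
    intro h
    by_contra hcon
    rw [h, mul_zero] at hR3
    exact mul_ne_zero (mul_ne_zero (mul_ne_zero hc0 (pow_ne_zero n hx0)) hy0) hcon hR3.symm
  by_cases hEt0 : E t = 0
  · exact ⟨hkey hEt0, hEt0⟩
  exfalso
  have hEx0 : E x ≠ 0 := by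
    intro h
    rw [h, mul_zero] at hR3
    exact mul_ne_zero (mul_ne_zero (mul_ne_zero hm0 hr0) (pow_ne_zero _ ht0)) hEt0 hR3
  have mq (p : A) (hp : p ∈ nilSubalgebra E) (i j : ℕ) :
      (i : A) * (p * E t) - (j : A) * (t * E p) ∈ nilSubalgebra E :=
    sub_mem (mul_mem (natCast_mem _ _) (mul_mem hp hEt))
      (mul_mem (natCast_mem _ _) (mul_mem ht (map_mem_nilSubalgebra hp)))
  have l1 : nilDegree E (t ^ (r + 1)) < nilDegree E x := by
    refine nilDegree_lt_of_dvd (mul_ne_zero hc0 hu0) (by simp [hEc, hu]) hx (pow_mem ht _)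
      (mq x hx (m * (r + 2)) (e + (n + 1) * m)) hEx0 ?_
    rw [← hc]; push_cast at hR3 ⊢
    linear_combination c * E x * (-h1) - x * hR3
  have l2 : nilDegree E (x ^ n * y) < nilDegree E t := by
    refine nilDegree_lt_of_dvd (mul_ne_zero (mul_ne_zero hm0 hr0) hu0)
      (by simp only [E.leibniz, E.map_natCast, hu, smul_zero, add_zero]) ht
      (mul_mem (pow_mem hx _) hy)
      (mq x hx (m * (r + 2)) (e + (n + 1) * m)) hEt0 ?_
    rw [← hc]; push_cast at hR3 ⊢
    linear_combination (m * (r + 2) : A) * E t * (-h1) - t * hR3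
  rw [nilDegree_pow ht ht0] at l1
  rw [nilDegree_mul (pow_mem hx _) hy (pow_ne_zero _ hx0) hy0, nilDegree_pow hx hx0] at l2
  rcases Nat.eq_zero_or_pos n with rfl | hn'
  · have he : e ≠ 0 := by rintro rfl; exact hne rfl
    have he0 : (e : A) ≠ 0 := by exact_mod_cast he
    have hEy0 : E y ≠ 0 := by
      intro h
      rw [h, mul_zero] at hR1
      exact mul_ne_zero (mul_ne_zero he0 hy0) hEx0 hR1
    have hR4 : c * x * E y = e * ((r + 2 : ℕ) : A) * t ^ (r + 1) * E t := by
      refine mul_left_cancel₀ hm0 ?_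
      linear_combination - (e : A) * hR3 - c * hR1
    have l3 : nilDegree E (t ^ (r + 1)) < nilDegree E y := by
      refine nilDegree_lt_of_dvd (mul_ne_zero hc0 hu0) (by simp [hEc, hu]) hy (pow_mem ht _)
        (mq y hy (e * (r + 2)) (e + (0 + 1) * m)) hEy0 ?_
      rw [← hc]; push_cast at hR4 ⊢
      linear_combination c * E y * (-h1) + y * hR4
    rw [nilDegree_pow ht ht0] at l3
    nlinarith [Nat.zero_le (r * nilDegree E t)]
  · nlinarith [Nat.zero_le (r * nilDegree E t), Nat.le_mul_of_pos_left (nilDegree E x) hn']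

end Relations

/-! ### Gradings and logarithmic derivations of a group algebra -/

noncomputable section Gradings

open AddMonoidAlgebra (supported supported_mono single)

variable {k G : Type*} [Field k]

theorem single_mem_supported {S : Set G} {g : G} (hg : g ∈ S) (c : k) :
    (single g c : AddMonoidAlgebra k G) ∈ supported k k S := by
  rw [AddMonoidAlgebra.mem_supported']
  intro h hh
  rw [AddMonoidAlgebra.coeff_single, Finsupp.single_eq_of_ne]
  rintro rfl; exact hh hg

variable [AddCommGroup G]

theorem mul_mem_supported {S T U : Set G} (hU : ∀ g ∈ S, ∀ h ∈ T, g + h ∈ U)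
    {a b : AddMonoidAlgebra k G} (ha : a ∈ supported k k S) (hb : b ∈ supported k k T) :
    a * b ∈ supported k k U := by
  classical
  rw [AddMonoidAlgebra.mem_supported] at *
  intro g hg
  obtain ⟨u, hu, v, hv, rfl⟩ :=
    Finset.mem_add.1 (AddMonoidAlgebra.support_coeff_mul_subset a b hg)
  exact hU u (ha hu) v (hb hv)

/-- Induction over the monomials of an element of the group algebra with support in `S`. -/
theorem supported_induction {S : Set G} {motive : AddMonoidAlgebra k G → Prop}
    (zero : motive 0) (add : ∀ a b, motive a → motive b → motive (a + b))
    (single : ∀ g ∈ S, ∀ c : k, motive (single g c)) {a : AddMonoidAlgebra k G}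
    (ha : a ∈ supported k k S) : motive a := by
  rw [AddMonoidAlgebra.supported_eq_span_single] at ha
  suffices ∀ c : k, motive (c • a) by simpa using this 1
  induction ha using Submodule.span_induction with
  | mem a h => obtain ⟨g, hg, rfl⟩ := h; simpa using fun c => single g hg c
  | zero => simpa using zero
  | add a b _ _ ha hb => intro c; rw [smul_add]; exact add _ _ (ha c) (hb c)
  | smul c a _ ha => intro c'; rw [smul_smul]; exact ha _

variable (k) in
/-- The elements of degree at most `i` with respect to the grading of the group algebra given by
`w : G →+ ℤ`. -/
def degLE (w : G →+ ℤ) (i : ℤ) : Submodule k (AddMonoidAlgebra k G) := supported k k {g | w g ≤ i}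

variable (k) in
/-- The homogeneous elements of degree `i` with respect to the grading given by `w`. -/
def homog (w : G →+ ℤ) (i : ℤ) : Submodule k (AddMonoidAlgebra k G) := supported k k {g | w g = i}

open Classical in
variable (k) in
/-- The projection onto the homogeneous elements of degree `i`. -/
def comp (w : G →+ ℤ) (i : ℤ) : AddMonoidAlgebra k G →ₗ[k] AddMonoidAlgebra k G where
  toFun a := .ofCoeff (a.coeff.filter fun g => w g = i)
  map_add' a b := by simp [Finsupp.filter_add]
  map_smul' c a := by simp [Finsupp.filter_smul]

variable {w : G →+ ℤ} {i j : ℤ} {a b : AddMonoidAlgebra k G}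

theorem mem_degLE : a ∈ degLE k w i ↔ ∀ g, i < w g → a.coeff g = 0 := by
  simp [degLE, AddMonoidAlgebra.mem_supported']

theorem mem_homog : a ∈ homog k w i ↔ ∀ g, w g ≠ i → a.coeff g = 0 := by
  simp [homog, AddMonoidAlgebra.mem_supported']

open Classical in
theorem coeff_comp (g : G) : (comp k w i a).coeff g = if w g = i then a.coeff g else 0 := by
  simp [comp, Finsupp.filter_apply]

theorem comp_mem_homog (w : G →+ ℤ) (i : ℤ) (a : AddMonoidAlgebra k G) :
    comp k w i a ∈ homog k w i := by
  rw [mem_homog]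
  intro g hg
  rw [coeff_comp, if_neg hg]

theorem comp_eq_self (h : a ∈ homog k w i) : comp k w i a = a := by
  ext g
  rw [coeff_comp]
  split_ifs with hg
  · rfl
  · exact (mem_homog.1 h g hg).symm

theorem comp_eq_zero (h : a ∈ degLE k w (i - 1)) : comp k w i a = 0 := by
  ext g
  rw [coeff_comp]
  split_ifs with hg
  · exact mem_degLE.1 h g (by omega)
  · rfl

theorem sub_comp_mem (h : a ∈ degLE k w i) : a - comp k w i a ∈ degLE k w (i - 1) := by
  rw [mem_degLE] at *
  intro g hg
  rw [AddMonoidAlgebra.coeff_sub, Finsupp.sub_apply, coeff_comp]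
  split_ifs with hgi
  · exact sub_self _
  · rw [sub_zero]; exact h g (by omega)

theorem mem_degLE_sub_one (h : a ∈ degLE k w i) (h0 : comp k w i a = 0) :
    a ∈ degLE k w (i - 1) := by
  simpa [h0] using sub_comp_mem h

theorem homog_le_degLE (w : G →+ ℤ) (i : ℤ) : homog k w i ≤ degLE k w i :=
  supported_mono fun _ h => le_of_eq h

theorem degLE_mono (w : G →+ ℤ) (h : i ≤ j) : degLE k w i ≤ degLE k w j :=
  supported_mono fun _ h' => le_trans h' h

theorem mul_mem_degLE (ha : a ∈ degLE k w i) (hb : b ∈ degLE k w j) :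
    a * b ∈ degLE k w (i + j) :=
  mul_mem_supported (fun _ hg _ hh => by
    rw [Set.mem_ofPred_eq, map_add]; exact add_le_add hg hh) ha hb

theorem mul_mem_homog (ha : a ∈ homog k w i) (hb : b ∈ homog k w j) :
    a * b ∈ homog k w (i + j) :=
  mul_mem_supported (fun _ hg _ hh => by
    rw [Set.mem_ofPred_eq, map_add, hg, hh]) ha hb

theorem one_mem_homog (w : G →+ ℤ) : (1 : AddMonoidAlgebra k G) ∈ homog k w 0 :=
  single_mem_supported (by simp) 1

theorem pow_mem_homog (ha : a ∈ homog k w i) (N : ℕ) : a ^ N ∈ homog k w (N * i) := by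
  induction N with
  | zero => simpa using one_mem_homog w
  | succ N ih => rw [pow_succ]; convert mul_mem_homog ih ha using 1; push_cast; ring_nf

theorem comp_mul (ha : a ∈ degLE k w i) (hb : b ∈ degLE k w j) :
    comp k w (i + j) (a * b) = comp k w i a * comp k w j b := by
  have h1 : a * b = comp k w i a * comp k w j b +
      ((a - comp k w i a) * b + comp k w i a * (b - comp k w j b)) := by ring
  have h2 : (a - comp k w i a) * b + comp k w i a * (b - comp k w j b) ∈
      degLE k w (i + j - 1) := by
    refine add_mem ?_ ?_
    · convert mul_mem_degLE (sub_comp_mem ha) hb using 1; ring_nf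
    · convert mul_mem_degLE (homog_le_degLE _ _ (comp_mem_homog w i a)) (sub_comp_mem hb) using 1
      ring_nf
  rw [h1, map_add, comp_eq_self (mul_mem_homog (comp_mem_homog _ _ _) (comp_mem_homog _ _ _)),
    comp_eq_zero h2, add_zero]

theorem exists_mem_degLE (w : G →+ ℤ) (a : AddMonoidAlgebra k G) : ∃ i, a ∈ degLE k w i := by
  obtain ⟨i, hi⟩ := (a.coeff.support.image w).bddAbove
  refine ⟨i, mem_degLE.2 fun g hg => ?_⟩
  by_contra h
  exact hg.not_ge (hi (by simpa using ⟨g, h, rfl⟩))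

theorem exists_notMem_degLE (w : G →+ ℤ) (ha : a ≠ 0) : ∃ g, ∀ i, a ∈ degLE k w i → w g ≤ i := by
  obtain ⟨g, hg⟩ : ∃ g, a.coeff g ≠ 0 := by
    by_contra! h
    exact ha (by ext g; exact h g)
  exact ⟨g, fun i hi => not_lt.1 fun h => hg (mem_degLE.1 hi g h)⟩

/-- Every nonzero element has a nonzero leading component. -/
theorem exists_comp_ne_zero (w : G →+ ℤ) (ha : a ≠ 0) :
    ∃ i, a ∈ degLE k w i ∧ comp k w i a ≠ 0 := by
  obtain ⟨g, hg⟩ := exists_notMem_degLE w ha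
  obtain ⟨i, hi, hmin⟩ := Int.exists_least_of_bdd ⟨w g, hg⟩ (exists_mem_degLE w a)
  refine ⟨i, hi, fun h => ?_⟩
  have := hmin _ (mem_degLE_sub_one hi h)
  omega

/-- The derivation that multiplies the monomial with exponent `g` by `φ g`. -/
def logDer (φ : G →+ AddMonoidAlgebra k G) :
    Derivation k (AddMonoidAlgebra k G) (AddMonoidAlgebra k G) :=
  Derivation.mk' ((Finsupp.linearCombination k
    fun g => (single g 1 : AddMonoidAlgebra k G) * φ g).comp
    (AddMonoidAlgebra.coeffLinearEquiv k).toLinearMap) <| by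
    have hs (g : G) (c : k) : ((Finsupp.linearCombination k
        fun g => (single g 1 : AddMonoidAlgebra k G) * φ g).comp
        (AddMonoidAlgebra.coeffLinearEquiv k).toLinearMap) (single g c) = single g c * φ g := by
      simp [← smul_mul_assoc]
    intro a b
    induction a using AddMonoidAlgebra.induction_linear with
    | zero => simp
    | add a a' ha ha' => simp only [add_mul, map_add, ha, ha', add_smul, smul_add]; abel
    | single g c =>
      induction b using AddMonoidAlgebra.induction_linear with
      | zero => simp
      | add b b' hb hb' => simp only [mul_add, map_add, hb, hb', add_smul, smul_add]; abel
      | single h d =>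
        rw [AddMonoidAlgebra.single_mul_single, hs, hs, hs, map_add,
          ← AddMonoidAlgebra.single_mul_single]
        simp only [smul_eq_mul]
        ring

theorem logDer_single (φ : G →+ AddMonoidAlgebra k G) (g : G) (c : k) :
    logDer φ (single g c) = single g c * φ g := by
  simp [logDer, ← smul_mul_assoc]

theorem logDer_mem_supported {φ : G →+ AddMonoidAlgebra k G} {S T U : Set G}
    (hU : ∀ g ∈ S, ∀ h ∈ T, g + h ∈ U) (hφ : ∀ g, φ g ∈ supported k k T)
    (ha : a ∈ supported k k S) : logDer φ a ∈ supported k k U := by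
  refine supported_induction (motive := fun a => logDer φ a ∈ supported k k U) ?_ ?_ ?_ ha
  · simp
  · intro a b ha hb
    rw [map_add]; exact add_mem ha hb
  · intro g hg c
    rw [logDer_single]
    exact mul_mem_supported hU (single_mem_supported hg c) (hφ g)

theorem logDer_mem_degLE {φ : G →+ AddMonoidAlgebra k G} (hφ : ∀ g, φ g ∈ degLE k w j)
    (ha : a ∈ degLE k w i) :
    logDer φ a ∈ degLE k w (i + j) :=
  logDer_mem_supported (fun _ hg _ hh => by
    rw [Set.mem_ofPred_eq, map_add]; exact add_le_add hg hh) hφ ha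

theorem logDer_mem_homog {φ : G →+ AddMonoidAlgebra k G} (hφ : ∀ g, φ g ∈ homog k w j)
    (ha : a ∈ homog k w i) :
    logDer φ a ∈ homog k w (i + j) :=
  logDer_mem_supported (fun _ hg _ hh => by
    rw [Set.mem_ofPred_eq, map_add, hg, hh]) hφ ha

variable (k) in
/-- The homogeneous component of degree `j` of an additive map to the group algebra. -/
def compHom (w : G →+ ℤ) (j : ℤ) (φ : G →+ AddMonoidAlgebra k G) : G →+ AddMonoidAlgebra k G :=
  (comp k w j).toAddMonoidHom.comp φ

/-- The leading component of `logDer φ a` is the value of the leading part of `logDer φ` at the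
leading component of `a`. -/
theorem comp_logDer {φ : G →+ AddMonoidAlgebra k G} (hφ : ∀ g, φ g ∈ degLE k w j)
    (ha : a ∈ degLE k w i) :
    comp k w (i + j) (logDer φ a) = logDer (compHom k w j φ) (comp k w i a) := by
  have h1 : logDer φ a = logDer (compHom k w j φ) (comp k w i a) +
      (logDer φ (a - comp k w i a) + logDer (φ - compHom k w j φ) (comp k w i a)) := by
    have h2 : logDer (φ - compHom k w j φ) (comp k w i a) =
        logDer φ (comp k w i a) - logDer (compHom k w j φ) (comp k w i a) := by
      induction comp k w i a using AddMonoidAlgebra.induction_linear with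
      | zero => simp
      | add a b ha hb => rw [map_add, map_add, map_add, ha, hb]; abel
      | single g c => simp only [logDer_single, AddMonoidHom.sub_apply, mul_sub]
    rw [h2, map_sub]
    abel
  have h3 : logDer φ (a - comp k w i a) + logDer (φ - compHom k w j φ) (comp k w i a) ∈
      degLE k w (i + j - 1) := by
    refine add_mem ?_ ?_
    · convert logDer_mem_degLE hφ (sub_comp_mem ha) using 1; ring_nf
    · convert logDer_mem_degLE (w := w) (j := j - 1) (φ := φ - compHom k w j φ) (fun g => ?_)
        (homog_le_degLE w i (comp_mem_homog w i a)) using 1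
      · ring_nf
      · exact sub_comp_mem (hφ g)
  rw [h1, map_add, comp_eq_self (logDer_mem_homog (fun g => comp_mem_homog _ _ _)
    (comp_mem_homog _ _ _)), comp_eq_zero h3, add_zero]

theorem iterate_logDer_mem_degLE {φ : G →+ AddMonoidAlgebra k G} (hφ : ∀ g, φ g ∈ degLE k w j)
    (ha : a ∈ degLE k w i) (N : ℕ) : (logDer φ)^[N] a ∈ degLE k w (i + N * j) := by
  induction N with
  | zero => simpa using ha
  | succ N ih =>
    rw [Function.iterate_succ_apply']
    convert logDer_mem_degLE hφ ih using 1
    push_cast; ring_nf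

theorem comp_iterate_logDer {φ : G →+ AddMonoidAlgebra k G} (hφ : ∀ g, φ g ∈ degLE k w j)
    (ha : a ∈ degLE k w i) (N : ℕ) :
    comp k w (i + N * j) ((logDer φ)^[N] a) = (logDer (compHom k w j φ))^[N] (comp k w i a) := by
  induction N with
  | zero => simp
  | succ N ih =>
    rw [Function.iterate_succ_apply', Function.iterate_succ_apply', ← ih,
      ← comp_logDer hφ (iterate_logDer_mem_degLE hφ ha N)]
    push_cast; ring_nf

/-- A nonzero logarithmic derivation has a nonzero leading part. -/
theorem exists_compHom_ne_zero [AddGroup.FG G] (w : G →+ ℤ) {φ : G →+ AddMonoidAlgebra k G}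
    (hφ : φ ≠ 0) :
    ∃ j, (∀ g, φ g ∈ degLE k w j) ∧ compHom k w j φ ≠ 0 := by
  have hb : ∃ j, ∀ g, φ g ∈ degLE k w j := by
    obtain ⟨S, hS⟩ := AddGroup.fg_def.1 ‹AddGroup.FG G›
    choose f hf using fun g => exists_mem_degLE w (φ g)
    obtain ⟨j, hj⟩ := (S.image f).bddAbove
    refine ⟨j, fun g => ?_⟩
    have hg : g ∈ AddSubgroup.closure (S : Set G) := hS ▸ AddSubgroup.mem_top g
    induction hg using AddSubgroup.closure_induction with
    | mem g hg => exact degLE_mono w (hj (Finset.mem_coe.2 (Finset.mem_image_of_mem f hg))) (hf g)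
    | zero => simp
    | add g h _ _ hg hh => rw [map_add]; exact add_mem hg hh
    | neg g _ hg => rw [map_neg]; exact neg_mem hg
  obtain ⟨g, hg⟩ : ∃ g, φ g ≠ 0 := by
    by_contra! h
    exact hφ (by ext1 g; exact h g)
  obtain ⟨h, hh⟩ := exists_notMem_degLE w hg
  obtain ⟨j, hj, hmin⟩ := Int.exists_least_of_bdd ⟨w h, fun j hj => hh j (hj g)⟩ hb
  refine ⟨j, hj, fun h0 => ?_⟩
  have := hmin (j - 1) fun g => mem_degLE_sub_one (hj g) (DFunLike.congr_fun h0 g)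
  omega

end Gradings

/-! ### Laurent polynomials and the associated graded ring -/

noncomputable section GradedRing

variable (k : Type*) [Field k]

/-- The ring `k[x, x⁻¹, s, s⁻¹, t, t⁻¹]` of Laurent polynomials. -/
abbrev Laurent : Type _ := AddMonoidAlgebra k (ℤ × ℤ × ℤ)

instance [CharZero k] : CharZero (Laurent k) :=
  charZero_of_injective_algebraMap (algebraMap k (Laurent k)).injective

instance : IsDomain (Laurent k) := NoZeroDivisors.to_isDomain _

/-- The monomial `x ^ i s ^ p t ^ q`. -/
def mon (i p q : ℤ) : Laurent k := AddMonoidAlgebra.single (i, p, q) 1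

variable {k}

theorem mon_mul_mon (i p q i' p' q' : ℤ) :
    mon k i p q * mon k i' p' q' = mon k (i + i') (p + p') (q + q') := by
  simp [mon, AddMonoidAlgebra.single_mul_single]

theorem mon_zero : mon k 0 0 0 = 1 := rfl

theorem mon_pow (i p q : ℤ) (N : ℕ) : mon k i p q ^ N = mon k (N * i) (N * p) (N * q) := by
  simp [mon, AddMonoidAlgebra.single_pow]

theorem mon_ne_zero (i p q : ℤ) : mon k i p q ≠ 0 := by simp [mon]

/-- The degree in `x⁻¹`. -/
def wtX : ℤ × ℤ × ℤ →+ ℤ := -AddMonoidHom.fst ℤ (ℤ × ℤ)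

/-- The degree for which `x`, `s` and `t` have the weights `0`, `r` and `d`. -/
def wtST (d r : ℕ) : ℤ × ℤ × ℤ →+ ℤ where
  toFun g := r * g.2.1 + d * g.2.2
  map_zero' := by simp
  map_add' g h := by simp only [Prod.fst_add, Prod.snd_add]; ring

theorem wtX_apply (g : ℤ × ℤ × ℤ) : wtX g = -g.1 := rfl

theorem mon_mem_supported {S : Set (ℤ × ℤ × ℤ)} {i p q : ℤ} (h : (i, p, q) ∈ S) :
    mon k i p q ∈ AddMonoidAlgebra.supported k k S :=
  single_mem_supported h 1

theorem mon_mem_homog_wtX {i p q j : ℤ} (h : -i = j) : mon k i p q ∈ homog k wtX j :=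
  mon_mem_supported (by exact h)

theorem mon_mem_homog_wtST {d r : ℕ} {i p q j : ℤ} (h : r * p + d * q = j) :
    mon k i p q ∈ homog k (wtST d r) j :=
  mon_mem_supported (by exact h)

variable (k) in
/-- The element `s ^ d + t ^ r`, the value at `x = 0` of `x ^ n y`. -/
def brieskorn (d r : ℕ) : Laurent k := mon k 0 d 0 + mon k 0 0 r

variable (k) in
/-- The leading form of `y`. -/
def grY (n d r : ℕ) : Laurent k := mon k (-n) 0 0 * brieskorn k d r

variable (k) in
/-- The leading form of `z`. -/
def grZ (n e m d r : ℕ) : Laurent k := mon k (-(n * m + e)) 0 0 * brieskorn k d r ^ m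

/-- The augmentation, that is, the value at `x = s = t = 1`. -/
def augmentation : Laurent k →ₐ[k] k := AddMonoidAlgebra.lift k k (ℤ × ℤ × ℤ) 1

theorem augmentation_mon (i p q : ℤ) : augmentation (mon k i p q) = 1 := by
  simp [augmentation, mon]

theorem augmentation_grZ_ne_zero [CharZero k] (n e m d r : ℕ) :
    augmentation (grZ k n e m d r) ≠ 0 := by
  simp only [grZ, brieskorn, map_mul, map_pow, map_add, augmentation_mon, one_mul]
  exact pow_ne_zero _ (by norm_num)

theorem brieskorn_ne_zero [CharZero k] (d r : ℕ) : brieskorn k d r ≠ 0 := by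
  intro h
  have := congrArg augmentation h
  simp only [brieskorn, map_add, augmentation_mon, map_zero] at this
  norm_num at this

theorem grY_ne_zero [CharZero k] (n d r : ℕ) : grY k n d r ≠ 0 :=
  mul_ne_zero (mon_ne_zero _ _ _) (brieskorn_ne_zero d r)

theorem grZ_ne_zero [CharZero k] (n e m d r : ℕ) : grZ k n e m d r ≠ 0 :=
  mul_ne_zero (mon_ne_zero _ _ _) (pow_ne_zero _ (brieskorn_ne_zero d r))

theorem brieskorn_mem_homog_wtX (d r : ℕ) : brieskorn k d r ∈ homog k wtX 0 :=
  add_mem (mon_mem_homog_wtX (by simp)) (mon_mem_homog_wtX (by simp))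

theorem brieskorn_mem_homog_wtST (d r : ℕ) : brieskorn k d r ∈ homog k (wtST d r) (d * r) :=
  add_mem (mon_mem_homog_wtST (by ring)) (mon_mem_homog_wtST (by ring))

theorem relation_grY (n d r : ℕ) :
    mon k 1 0 0 ^ n * grY k n d r = mon k 0 1 0 ^ d + mon k 0 0 1 ^ r := by
  rw [grY, ← mul_assoc, mon_pow, mon_mul_mon, mon_pow, mon_pow]
  simp [mon_zero, brieskorn]

theorem relation_grZ (n e m d r : ℕ) :
    mon k 1 0 0 ^ e * grZ k n e m d r = grY k n d r ^ m := by
  rw [grY, grZ, ← mul_assoc, mon_pow, mon_mul_mon, mul_pow, mon_pow]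
  congr 2; ring

variable (k) in
/-- The monomial `x ^ a y ^ b z ^ c s ^ p t ^ q` in the leading forms of `x, y, z, s, t`. -/
def grMon (n e m d r a b c p q : ℕ) : Laurent k :=
  mon k a p q * grY k n d r ^ b * grZ k n e m d r ^ c

theorem grMon_eq (n e m d r a b c p q : ℕ) : grMon k n e m d r a b c p q =
    mon k (a - n * b - (n * m + e) * c) p q * brieskorn k d r ^ (b + m * c) := by
  rw [grMon, grY, grZ, mul_pow, mul_pow, mon_pow, mon_pow, pow_add, pow_mul]
  have : mon k (a - n * b - (n * m + e) * c) p q = mon k a p q *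
      mon k (b * -(n : ℤ)) (b * 0) (b * 0) * mon k (c * -((n * m + e : ℤ))) (c * 0) (c * 0) := by
    rw [mon_mul_mon, mon_mul_mon]; congr 1; ring
  rw [this]
  ring

theorem grMon_mem_homog_wtST (n e m d r a b c p q : ℕ) : grMon k n e m d r a b c p q ∈
    homog k (wtST d r) (d * r * (b + m * c) + r * p + d * q) := by
  rw [grMon_eq]
  convert mul_mem_homog (mon_mem_homog_wtST rfl)
    (pow_mem_homog (brieskorn_mem_homog_wtST d r) _) using 2
  push_cast
  ring

theorem grMon_mul (n e m d r a b c p q a' b' c' p' q' : ℕ) :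
    grMon k n e m d r a b c p q * grMon k n e m d r a' b' c' p' q' =
      grMon k n e m d r (a + a') (b + b') (c + c') (p + p') (q + q') := by
  simp only [grMon, pow_add]
  push_cast
  rw [← mon_mul_mon]
  ring

variable (k) in
/-- The homogeneous component of degree `w` of the associated graded ring, as a subspace of the
Laurent polynomials. -/
def grPiece (n e m d r : ℕ) (w : ℤ) : Submodule k (Laurent k) :=
  Submodule.span k {u | ∃ a b c p q : ℕ, -(a : ℤ) + n * b + (n * m + e) * c = w ∧
    grMon k n e m d r a b c p q = u}

variable (k) in
/-- The homogeneous component of bidegree `(w, v)` of the associated graded ring. -/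
def grBipiece (n e m d r : ℕ) (w v : ℤ) : Submodule k (Laurent k) :=
  Submodule.span k {u | ∃ a b c p q : ℕ, -(a : ℤ) + n * b + (n * m + e) * c = w ∧
    (d * r * (b + m * c) + r * p + d * q : ℤ) = v ∧ grMon k n e m d r a b c p q = u}

variable (k) in
/-- The associated graded ring `k[x, x ^ (-n) f, x ^ (-(n m + e)) f ^ m, s, t]` of `B`, where
`f = s ^ d + t ^ r`, as a subalgebra of the Laurent polynomials. -/
def grAlg (n e m d r : ℕ) : Subalgebra k (Laurent k) :=
  Algebra.adjoin k {mon k 1 0 0, grY k n d r, grZ k n e m d r, mon k 0 1 0, mon k 0 0 1}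

section

variable {n e m d r : ℕ}

theorem mon_mem_grAlg (a p q : ℕ) : mon k a p q ∈ grAlg k n e m d r := by
  have h : mon k a p q = mon k 1 0 0 ^ a * mon k 0 1 0 ^ p * mon k 0 0 1 ^ q := by
    simp [mon_pow, mon_mul_mon]
  rw [h]
  exact mul_mem (mul_mem (pow_mem (Algebra.subset_adjoin (by simp)) _)
    (pow_mem (Algebra.subset_adjoin (by simp)) _)) (pow_mem (Algebra.subset_adjoin (by simp)) _)

theorem grY_mem_grAlg : grY k n d r ∈ grAlg k n e m d r := Algebra.subset_adjoin (by simp)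

theorem grZ_mem_grAlg : grZ k n e m d r ∈ grAlg k n e m d r := Algebra.subset_adjoin (by simp)

theorem grMon_mem_grAlg (a b c p q : ℕ) : grMon k n e m d r a b c p q ∈ grAlg k n e m d r :=
  mul_mem (mul_mem (mon_mem_grAlg _ _ _) (pow_mem grY_mem_grAlg _)) (pow_mem grZ_mem_grAlg _)

theorem grMon_mem_grPiece {a b c p q : ℕ} {w : ℤ}
    (h : -(a : ℤ) + n * b + (n * m + e) * c = w) :
    grMon k n e m d r a b c p q ∈ grPiece k n e m d r w :=
  Submodule.subset_span ⟨a, b, c, p, q, h, rfl⟩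

theorem grMon_mem_grBipiece {a b c p q : ℕ} {w v : ℤ}
    (h : -(a : ℤ) + n * b + (n * m + e) * c = w)
    (h' : (d * r * (b + m * c) + r * p + d * q : ℤ) = v) :
    grMon k n e m d r a b c p q ∈ grBipiece k n e m d r w v :=
  Submodule.subset_span ⟨a, b, c, p, q, h, h', rfl⟩

theorem grZ_eq_grMon : grZ k n e m d r = grMon k n e m d r 0 0 1 0 0 := by
  simp [grMon, mon_zero]

theorem mon_eq_grMon (a p q : ℕ) : mon k a p q = grMon k n e m d r a 0 0 p q := by
  simp [grMon]

theorem grBipiece_le_homog (w v : ℤ) : grBipiece k n e m d r w v ≤ homog k (wtST d r) v := by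
  refine Submodule.span_le.2 ?_
  rintro _ ⟨a, b, c, p, q, -, rfl, rfl⟩
  exact grMon_mem_homog_wtST _ _ _ _ _ _ _ _ _ _

theorem grBipiece_le_grPiece (w v : ℤ) : grBipiece k n e m d r w v ≤ grPiece k n e m d r w := by
  refine Submodule.span_mono ?_
  rintro _ ⟨a, b, c, p, q, h, -, rfl⟩
  exact ⟨a, b, c, p, q, h, rfl⟩

theorem comp_mem_grBipiece {w v : ℤ} {u : Laurent k} (hu : u ∈ grPiece k n e m d r w) :
    comp k (wtST d r) v u ∈ grBipiece k n e m d r w v := by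
  suffices grPiece k n e m d r w ≤ (grBipiece k n e m d r w v).comap (comp k (wtST d r) v) from
    this hu
  refine Submodule.span_le.2 ?_
  rintro _ ⟨a, b, c, p, q, h, rfl⟩
  rw [SetLike.mem_coe, Submodule.mem_comap]
  have hh := grMon_mem_homog_wtST (k := k) n e m d r a b c p q
  by_cases hv : (d * r * (b + m * c) + r * p + d * q : ℤ) = v
  · rw [hv] at hh
    rw [comp_eq_self hh]
    exact grMon_mem_grBipiece h hv
  · have : comp k (wtST d r) v (grMon k n e m d r a b c p q) = 0 := by
      ext g
      rw [coeff_comp]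
      split_ifs with hg
      · exact mem_homog.1 hh g (by rw [hg]; exact Ne.symm hv)
      · rfl
    rw [this]
    exact zero_mem _

theorem mul_mem_grBipiece {w v w' v' : ℤ} {u u' : Laurent k}
    (hu : u ∈ grBipiece k n e m d r w v) (hu' : u' ∈ grBipiece k n e m d r w' v') :
    u * u' ∈ grBipiece k n e m d r (w + w') (v + v') := by
  have : u * u' ∈ grBipiece k n e m d r w v * grBipiece k n e m d r w' v' :=
    Submodule.mul_mem_mul hu hu'
  rw [grBipiece, grBipiece, Submodule.span_mul_span] at this
  refine Submodule.span_mono ?_ this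
  rintro _ ⟨_, ⟨a, b, c, p, q, rfl, rfl, rfl⟩, _, ⟨a', b', c', p', q', rfl, rfl, rfl⟩, rfl⟩
  refine ⟨_, _, _, _, _, ?_, ?_, (grMon_mul ..).symm⟩
  · push_cast; ring
  · push_cast; ring

theorem pow_mem_grBipiece {w v : ℤ} {u : Laurent k}
    (hu : u ∈ grBipiece k n e m d r w v) (N : ℕ) :
    u ^ N ∈ grBipiece k n e m d r (N * w) (N * v) := by
  induction N with
  | zero =>
    rw [pow_zero, ← mon_zero]
    exact mon_eq_grMon (k := k) (n := n) (e := e) (m := m) (d := d) (r := r) 0 0 0 ▸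
      grMon_mem_grBipiece (by simp) (by simp)
  | succ N ih =>
    rw [pow_succ]
    convert mul_mem_grBipiece ih hu using 1
    push_cast
    ring_nf

theorem grPiece_le_map {w : ℤ} (g : Laurent k)
    (h : ∀ a b c p q : ℕ, -(a : ℤ) + n * b + (n * m + e) * c = w →
      ∃ u ∈ grAlg k n e m d r, grMon k n e m d r a b c p q = g * u) {u : Laurent k}
    (hu : u ∈ grPiece k n e m d r w) : ∃ u' ∈ grAlg k n e m d r, u = g * u' := by
  suffices grPiece k n e m d r w ≤
      (Subalgebra.toSubmodule (grAlg k n e m d r)).map (LinearMap.mulLeft k g) by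
    obtain ⟨u', h1, h2⟩ := this hu
    exact ⟨u', h1, h2.symm⟩
  refine Submodule.span_le.2 ?_
  rintro _ ⟨a, b, c, p, q, hw, rfl⟩
  obtain ⟨u', h1, h2⟩ := h a b c p q hw
  exact ⟨u', h1, h2.symm⟩

theorem exists_eq_x_mul {w : ℤ} (hw : w < 0) {u : Laurent k} (hu : u ∈ grPiece k n e m d r w) :
    ∃ u' ∈ grAlg k n e m d r, u = mon k 1 0 0 * u' := by
  refine grPiece_le_map _ (fun a b c p q h => ?_) hu
  obtain ⟨a, rfl⟩ : ∃ a', a = a' + 1 := by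
    refine Nat.exists_eq_add_of_le' ?_
    have : (0 : ℤ) ≤ n * b + (n * m + e) * c := by positivity
    omega
  refine ⟨_, grMon_mem_grAlg a b c p q, ?_⟩
  rw [show mon k 1 0 0 = grMon k n e m d r 1 0 0 0 0 from mon_eq_grMon 1 0 0, grMon_mul]
  congr 1 <;> omega

/-- In degrees above `n (m - 1)` every monomial is divisible by `z`, possibly after replacing
`y ^ m` by `x ^ e z`. -/
theorem exists_eq_grZ_mul {w : ℤ} (hw : n * (m - 1 : ℤ) < w) {u : Laurent k}
    (hu : u ∈ grPiece k n e m d r w) :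
    ∃ u' ∈ grAlg k n e m d r, u = grZ k n e m d r * u' := by
  refine grPiece_le_map _ (fun a b c p q h => ?_) hu
  rcases c with _ | c
  · obtain ⟨b, rfl⟩ : ∃ b', b = b' + m := by
      refine Nat.exists_eq_add_of_le' ?_
      by_contra! hb
      have : (n : ℤ) * b ≤ n * (m - 1) := by gcongr; omega
      push_cast at h
      linarith [Int.natCast_nonneg a]
    refine ⟨_, grMon_mem_grAlg (a + e) b 0 p q, ?_⟩
    rw [grMon, pow_add, ← relation_grZ n e m d r]
    rw [grMon, Nat.cast_add, show mon k ((a : ℤ) + e) p q = mon k a p q * mon k 1 0 0 ^ e by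
      rw [mon_pow, mon_mul_mon]; simp]
    ring
  · refine ⟨_, grMon_mem_grAlg a b c p q, ?_⟩
    rw [grMon, pow_succ, grMon]
    ring

/-- Every monomial of positive degree is divisible by `y` or by `z`, and `y ^ m` is divisible by
`z`. -/
theorem exists_pow_eq_grZ_mul {w : ℤ} (hw : 0 < w) {u : Laurent k}
    (hu : u ∈ grPiece k n e m d r w) :
    ∃ u' ∈ grAlg k n e m d r, u ^ m = grZ k n e m d r * u' := by
  obtain ⟨v, hv, v', hv', rfl⟩ : ∃ v ∈ grAlg k n e m d r, ∃ v' ∈ grAlg k n e m d r,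
      u = grY k n d r * v + grZ k n e m d r * v' := by
    suffices grPiece k n e m d r w ≤
        (Subalgebra.toSubmodule (grAlg k n e m d r)).map (LinearMap.mulLeft k (grY k n d r)) ⊔
        (Subalgebra.toSubmodule (grAlg k n e m d r)).map
          (LinearMap.mulLeft k (grZ k n e m d r)) by
      obtain ⟨_, ⟨v, hv, rfl⟩, _, ⟨v', hv', rfl⟩, h⟩ := Submodule.mem_sup.1 (this hu)
      exact ⟨v, hv, v', hv', h.symm⟩
    refine Submodule.span_le.2 ?_
    rintro _ ⟨a, b, c, p, q, h, rfl⟩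
    rcases c with _ | c
    · rcases b with _ | b
      · simp only [Nat.cast_zero, mul_zero, add_zero] at h
        omega
      · refine Submodule.mem_sup_left ⟨_, grMon_mem_grAlg a b 0 p q, ?_⟩
        simp only [LinearMap.mulLeft_apply, grMon, pow_succ]
        ring
    · refine Submodule.mem_sup_right ⟨_, grMon_mem_grAlg a b c p q, ?_⟩
      simp only [LinearMap.mulLeft_apply, grMon, pow_succ]
      ring
  obtain ⟨j, hj⟩ : ∃ j ∈ grAlg k n e m d r, (grY k n d r * v + grZ k n e m d r * v') ^ m =
      (grY k n d r * v) ^ m + grZ k n e m d r * v' * j := by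
    have h1 : ∀ N : ℕ, ∃ j ∈ grAlg k n e m d r, (grY k n d r * v + grZ k n e m d r * v') ^ N =
        (grY k n d r * v) ^ N + grZ k n e m d r * v' * j := by
      intro N
      induction N with
      | zero => exact ⟨0, zero_mem _, by simp⟩
      | succ N ih =>
        obtain ⟨j, hj, h⟩ := ih
        refine ⟨(grY k n d r * v) ^ N + j * (grY k n d r * v + grZ k n e m d r * v'), ?_, ?_⟩
        · exact add_mem (pow_mem (mul_mem grY_mem_grAlg hv) _) (mul_mem hj (add_mem
            (mul_mem grY_mem_grAlg hv) (mul_mem grZ_mem_grAlg hv')))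
        · rw [pow_succ, h, pow_succ]; ring
    exact h1 m
  refine ⟨mon k 1 0 0 ^ e * v ^ m + v' * j, add_mem (mul_mem (pow_mem (mon_mem_grAlg 1 0 0) _)
    (pow_mem hv _)) (mul_mem hv' hj.1), ?_⟩
  rw [hj.2, mul_pow, ← relation_grZ n e m d r]
  ring

end

end GradedRing

/-! ### Bihomogeneous locally nilpotent derivations of the graded ring -/

noncomputable section Bihomogeneous

open AddMonoidAlgebra (supported supported_mono single)

variable {k : Type*} [Field k] {n e m d r : ℕ}

variable (k) in
/-- The polynomials in `s` and `t`, as a subspace of the Laurent polynomials. -/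
def polyST : Submodule k (Laurent k) := supported k k {g | g.1 = 0 ∧ 0 ≤ g.2.1 ∧ 0 ≤ g.2.2}

variable (k) in
/-- The quasi-homogeneous polynomials of degree `v` in `s` and `t`, where `s` has weight `r` and `t`
has weight `d`. -/
def qhPoly (d r : ℕ) (v : ℤ) : Submodule k (Laurent k) :=
  supported k k {g | g.1 = 0 ∧ 0 ≤ g.2.1 ∧ 0 ≤ g.2.2 ∧ r * g.2.1 + d * g.2.2 = v}

theorem single_eq_smul_mon (i p q : ℤ) (c : k) : single (i, p, q) c = c • mon k i p q := by
  simp [mon]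

theorem polyST_le_grAlg : polyST k ≤ Subalgebra.toSubmodule (grAlg k n e m d r) := by
  intro h hh
  refine supported_induction (motive := fun h => h ∈ grAlg k n e m d r) (zero_mem _)
    (fun _ _ => add_mem) ?_ hh
  rintro ⟨i, p, q⟩ ⟨hi, hp, hq⟩ c
  dsimp only at hi hp hq
  lift p to ℕ using hp
  lift q to ℕ using hq
  rw [single_eq_smul_mon, hi]
  exact Subalgebra.smul_mem _ (mon_mem_grAlg 0 p q) c

theorem qhPoly_le_polyST (v : ℤ) : qhPoly k d r v ≤ polyST k :=
  supported_mono fun _ h => ⟨h.1, h.2.1, h.2.2.1⟩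

theorem mul_mem_qhPoly {v v' : ℤ} {a b : Laurent k} (ha : a ∈ qhPoly k d r v)
    (hb : b ∈ qhPoly k d r v') : a * b ∈ qhPoly k d r (v + v') := by
  refine mul_mem_supported ?_ ha hb
  rintro g ⟨h1, h2, h3, h4⟩ h ⟨h1', h2', h3', h4'⟩
  refine ⟨?_, ?_, ?_, ?_⟩
  · simp [h1, h1']
  · exact add_nonneg h2 h2'
  · exact add_nonneg h3 h3'
  · simp only [Prod.snd_add, Prod.fst_add]
    linear_combination h4 + h4'

theorem mon_mem_qhPoly {p q : ℕ} {v : ℤ} (h : (r * p + d * q : ℤ) = v) :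
    mon k 0 p q ∈ qhPoly k d r v :=
  mon_mem_supported (by exact ⟨rfl, Int.natCast_nonneg _, Int.natCast_nonneg _, h⟩)

theorem brieskorn_mem_qhPoly : brieskorn k d r ∈ qhPoly k d r (d * r) := by
  refine add_mem ?_ ?_
  · exact mon_mem_qhPoly (p := d) (q := 0) (by push_cast; ring)
  · exact mon_mem_qhPoly (p := 0) (q := r) (by push_cast; ring)

theorem brieskorn_pow_mem_qhPoly (N : ℕ) :
    brieskorn k d r ^ N ∈ qhPoly k d r (N * (d * r)) := by
  induction N with
  | zero => simpa [mon_zero] using mon_mem_qhPoly (k := k) (d := d) (r := r) (p := 0) (q := 0) rfl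
  | succ N ih =>
    rw [pow_succ]
    convert mul_mem_qhPoly ih brieskorn_mem_qhPoly using 1
    push_cast
    ring_nf

/-- In the degrees `w (n m + e)`, with `w ≥ 0`, the graded ring is `z ^ w k[s, t]`. -/
theorem exists_eq_grZ_pow_mul (hM : 0 < n * m + e) {w : ℕ} {v : ℤ} {u : Laurent k}
    (hu : u ∈ grBipiece k n e m d r ((n * m + e : ℕ) * w) v) :
    ∃ h ∈ qhPoly k d r (v - w * (d * r * m)), u = grZ k n e m d r ^ w * h := by
  suffices grBipiece k n e m d r ((n * m + e : ℕ) * w) v ≤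
      (qhPoly k d r (v - w * (d * r * m))).map (LinearMap.mulLeft k (grZ k n e m d r ^ w)) by
    obtain ⟨u', h1, h2⟩ := this hu
    exact ⟨u', h1, h2.symm⟩
  refine Submodule.span_le.2 ?_
  rintro _ ⟨a, b, c, p, q, hw, hv, rfl⟩
  obtain ⟨j, hj⟩ : ∃ j, b + m * c = m * w + j := by
    refine Nat.exists_eq_add_of_le ?_
    have h1 : (n * m + e) * w ≤ n * b + (n * m + e) * c := by zify; push_cast at hw; omega
    have h2 : (n * m + e) * (m * w) ≤ (n * m + e) * (b + m * c) := by
      calc (n * m + e) * (m * w) = m * ((n * m + e) * w) := by ring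
        _ ≤ m * (n * b + (n * m + e) * c) := Nat.mul_le_mul_left m h1
        _ ≤ (n * m + e) * (b + m * c) := by nlinarith [Nat.zero_le (e * b)]
    exact Nat.le_of_mul_le_mul_left h2 hM
  refine ⟨mon k 0 p q * brieskorn k d r ^ j, ?_, ?_⟩
  · have hj' : (b + m * c : ℤ) = m * w + j := by exact_mod_cast hj
    rw [show v - w * (d * r * m) = (r * p + d * q) + j * (d * r) by
      linear_combination (d * r : ℤ) * hj' - hv]
    exact mul_mem_qhPoly (mon_mem_qhPoly rfl) (brieskorn_pow_mem_qhPoly j)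
  · rw [LinearMap.mulLeft_apply, grMon_eq, hj, grZ, mul_pow, mon_pow, pow_add, pow_mul]
    have : mon k (a - n * b - (n * m + e) * c) p q =
        mon k (w * -((n * m + e : ℤ))) (w * 0) (w * 0) * mon k 0 p q := by
      rw [mon_mul_mon]
      congr 1
      · push_cast at hw; linear_combination - hw
      · ring
      · ring
    rw [this]
    ring

/-- Euler's identity and the chain rule for a quasi-homogeneous polynomial in `s ^ d` and
`t ^ r`. -/
theorem exists_euler (E : Derivation k (Laurent k) (Laurent k)) (hd : 1 ≤ d) (hr : 1 ≤ r) {v : ℤ}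
    {h : Laurent k} (hh : h ∈ supported k k {g : ℤ × ℤ × ℤ | g.1 = 0 ∧ r * g.2.1 + d * g.2.2 = v ∧
      (g.2.1 = 0 ∨ d ≤ g.2.1) ∧ (g.2.2 = 0 ∨ r ≤ g.2.2)}) :
    ∃ a ∈ polyST k, ∃ b ∈ polyST k,
      (v : Laurent k) * h =
        (r : Laurent k) * mon k 0 1 0 ^ d * a + (d : Laurent k) * mon k 0 0 1 ^ r * b ∧
      E h = mon k 0 1 0 ^ (d - 1) * a * E (mon k 0 1 0) +
        mon k 0 0 1 ^ (r - 1) * b * E (mon k 0 0 1) := by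
  refine supported_induction (motive := fun h => ∃ a ∈ polyST k, ∃ b ∈ polyST k,
      (v : Laurent k) * h =
        (r : Laurent k) * mon k 0 1 0 ^ d * a + (d : Laurent k) * mon k 0 0 1 ^ r * b ∧
      E h = mon k 0 1 0 ^ (d - 1) * a * E (mon k 0 1 0) +
        mon k 0 0 1 ^ (r - 1) * b * E (mon k 0 0 1)) ?_ ?_ ?_ hh
  · exact ⟨0, zero_mem _, 0, zero_mem _, by simp, by simp⟩
  · rintro h h' ⟨a, ha, b, hb, h1, h2⟩ ⟨a', ha', b', hb', h1', h2'⟩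
    refine ⟨a + a', add_mem ha ha', b + b', add_mem hb hb', ?_, ?_⟩
    · linear_combination h1 + h1'
    · rw [map_add]; linear_combination h2 + h2'
  · rintro ⟨i, p, q⟩ ⟨hi, hv, hp, hq⟩ c
    dsimp only at hi hv hp hq
    obtain ⟨p, rfl⟩ : ∃ p' : ℕ, p = p' := ⟨p.toNat, by omega⟩
    obtain ⟨q, rfl⟩ : ∃ q' : ℕ, q = q' := ⟨q.toNat, by omega⟩
    -- the partial derivatives, divided by `s ^ (d - 1)` and by `t ^ (r - 1)`
    have key (j N : ℕ) (hj : 1 ≤ j) (hN : (N : ℤ) = 0 ∨ (j : ℤ) ≤ N) (g : Laurent k) :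
        ∃ i : ℕ, (N : Laurent k) * g ^ N = g ^ j * (N * g ^ i) ∧
          (N : Laurent k) * g ^ (N - 1) = g ^ (j - 1) * (N * g ^ i) := by
      rcases hN with hN | hN
      · obtain rfl : N = 0 := by exact_mod_cast hN
        exact ⟨0, by simp, by simp⟩
      · obtain ⟨i, rfl⟩ := Nat.exists_eq_add_of_le (show j ≤ N by exact_mod_cast hN)
        refine ⟨i, by ring, ?_⟩
        rw [show j + i - 1 = (j - 1) + i by omega]
        ring
    obtain ⟨p', hp1, hp2⟩ := key d p hd hp (mon k 0 1 0)
    obtain ⟨q', hq1, hq2⟩ := key r q hr hq (mon k 0 0 1)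
    have hmon (i j : ℕ) : mon k 0 1 0 ^ i * mon k 0 0 1 ^ j ∈ polyST k := by
      have : mon k 0 1 0 ^ i * mon k 0 0 1 ^ j = mon k 0 i j := by simp [mon_pow, mon_mul_mon]
      rw [this]
      exact qhPoly_le_polyST (d := 1) (r := 1) _ (mon_mem_qhPoly rfl)
    refine ⟨(c * p) • (mon k 0 1 0 ^ p' * mon k 0 0 1 ^ q), Submodule.smul_mem _ _ (hmon _ _),
      (c * q) • (mon k 0 1 0 ^ p * mon k 0 0 1 ^ q'), Submodule.smul_mem _ _ (hmon _ _), ?_, ?_⟩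
    · have : mon k 0 p q = mon k 0 1 0 ^ p * mon k 0 0 1 ^ q := by simp [mon_pow, mon_mul_mon]
      rw [hi, single_eq_smul_mon, this, ← hv]
      simp only [Algebra.smul_def, map_mul, map_natCast]
      push_cast
      linear_combination (algebraMap k (Laurent k) c) * r * mon k 0 0 1 ^ q * hp1 +
        (algebraMap k (Laurent k) c) * d * mon k 0 1 0 ^ p * hq1
    · have : mon k 0 p q = mon k 0 1 0 ^ p * mon k 0 0 1 ^ q := by simp [mon_pow, mon_mul_mon]
      rw [hi, single_eq_smul_mon, this, E.map_smul, E.leibniz, E.leibniz_pow, E.leibniz_pow]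
      simp only [smul_eq_mul, nsmul_eq_mul]
      simp only [Algebra.smul_def, map_mul, map_natCast]
      linear_combination (algebraMap k (Laurent k) c) * mon k 0 0 1 ^ q * E (mon k 0 1 0) * hp2 +
        (algebraMap k (Laurent k) c) * mon k 0 1 0 ^ p * E (mon k 0 0 1) * hq2

theorem eq_zero_of_logDer_eq_zero {φ : ℤ × ℤ × ℤ →+ Laurent k}
    (hx : logDer φ (mon k 1 0 0) = 0) (hs : logDer φ (mon k 0 1 0) = 0)
    (ht : logDer φ (mon k 0 0 1) = 0) : φ = 0 := by
  have h (i p q : ℤ) (h : logDer φ (mon k i p q) = 0) : φ (i, p, q) = 0 := by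
    rw [mon, logDer_single] at h
    exact (mul_eq_zero.1 h).resolve_left (mon_ne_zero i p q)
  refine AddMonoidHom.ext ?_
  rintro ⟨i, p, q⟩
  have h1 : (i, p, q) = i • ((1, 0, 0) : ℤ × ℤ × ℤ) + p • ((0, 1, 0) : ℤ × ℤ × ℤ) +
      q • ((0, 0, 1) : ℤ × ℤ × ℤ) := by simp
  rw [h1, map_add, map_add, map_zsmul, map_zsmul, map_zsmul, h _ _ _ hx, h _ _ _ hs, h _ _ _ ht]
  simp

variable [CharZero k] {φ : ℤ × ℤ × ℤ →+ Laurent k}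

theorem eq_zero_of_map_s_or_map_t (hn : 1 ≤ n) (hne : (n, e) ≠ (1, 0)) (hm : 1 ≤ m) (hd : 2 ≤ d)
    (hr : 2 ≤ r) (hnil : grAlg k n e m d r ≤ nilSubalgebra (logDer φ))
    (hz : logDer φ (grZ k n e m d r) = 0)
    (h : logDer φ (mon k 0 1 0) = 0 ∨ logDer φ (mon k 0 0 1) = 0) : φ = 0 := by
  have hx := hnil (mon_mem_grAlg 1 0 0)
  have hs := hnil (mon_mem_grAlg 0 1 0)
  have ht := hnil (mon_mem_grAlg 0 0 1)
  have hy := hnil grY_mem_grAlg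
  rcases h with h | h
  · obtain ⟨h1, h2⟩ := map_eq_zero_of_relations hn hne hm hr hx hy ht (mon_ne_zero _ _ _)
      (grY_ne_zero n d r) (pow_ne_zero d (mon_ne_zero _ _ _)) (mon_ne_zero _ _ _) hz
      (by simp [Derivation.leibniz_pow, h]) (relation_grY n d r) (relation_grZ n e m d r)
    exact eq_zero_of_logDer_eq_zero h1 h h2
  · obtain ⟨h1, h2⟩ := map_eq_zero_of_relations hn hne hm hd hx hy hs (mon_ne_zero _ _ _)
      (grY_ne_zero n d r) (pow_ne_zero r (mon_ne_zero _ _ _)) (mon_ne_zero _ _ _) hz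
      (by simp [Derivation.leibniz_pow, h]) ((relation_grY n d r).trans (add_comm _ _))
      (relation_grZ n e m d r)
    exact eq_zero_of_logDer_eq_zero h1 h2 h

theorem map_eq_zero_of_dvd_qhPoly {v : ℤ} {h : Laurent k} (hh : h ∈ qhPoly k d r v) (h0 : h ≠ 0)
    (hnil : grAlg k n e m d r ≤ nilSubalgebra (logDer φ)) (hEh : logDer φ h = 0) {p q : ℕ}
    (hdvd : ∀ g, h.coeff g ≠ 0 → p ≤ g.2.1 ∧ q ≤ g.2.2) :
    logDer φ (mon k 0 p q) = 0 := by
  have h1 : h = mon k 0 p q * (mon k 0 (-p) (-q) * h) := by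
    rw [← mul_assoc, mon_mul_mon]; simp [mon_zero]
  have h2 : mon k 0 (-p) (-q) * h ∈ polyST k := by
    have h3 : h ∈ supported k k {g : ℤ × ℤ × ℤ | g.1 = 0 ∧ p ≤ g.2.1 ∧ q ≤ g.2.2} := by
      rw [AddMonoidAlgebra.mem_supported]
      intro g hg
      have hg' : h.coeff g ≠ 0 := by simpa using hg
      exact ⟨(hh hg).1, hdvd g hg'⟩
    refine mul_mem_supported (S := {((0 : ℤ), (-p : ℤ), (-q : ℤ))}) ?_
      (mon_mem_supported rfl) h3
    rintro _ rfl g ⟨h1, h2, h3⟩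
    refine ⟨?_, ?_, ?_⟩
    · simp [h1]
    · simpa using h2
    · simpa using h3
  refine map_eq_zero_of_mul (hnil (mon_mem_grAlg 0 p q)) (hnil (polyST_le_grAlg h2)) ?_ ?_
  · exact fun h4 => h0 (h1.trans h4)
  · have := congrArg (logDer φ) h1
    rw [hEh] at this
    exact this.symm

/-- A locally nilpotent derivation of the graded ring that kills `z` and a nonconstant
quasi-homogeneous polynomial in `s` and `t` vanishes. -/
theorem eq_zero_of_map_qhPoly (hn : 1 ≤ n) (hne : (n, e) ≠ (1, 0)) (hm : 1 ≤ m) (hd : 2 ≤ d)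
    (hr : 2 ≤ r) (hdr : Nat.gcd d r = 1) (hnil : grAlg k n e m d r ≤ nilSubalgebra (logDer φ))
    (hz : logDer φ (grZ k n e m d r) = 0) {v : ℤ} (hv : v ≠ 0) {h : Laurent k}
    (hh : h ∈ qhPoly k d r v) (h0 : h ≠ 0) (hEh : logDer φ h = 0) : φ = 0 := by
  refine eq_zero_of_map_s_or_map_t hn hne hm hd hr hnil hz ?_
  by_cases hs : ∀ g, h.coeff g ≠ 0 → 1 ≤ g.2.1
  · have := map_eq_zero_of_dvd_qhPoly (p := 1) (q := 0) hh h0 hnil hEh fun g hg =>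
      ⟨by exact_mod_cast hs g hg, (hh (Finset.mem_coe.2 (Finsupp.mem_support_iff.2 hg))).2.2.1⟩
    exact Or.inl (by exact_mod_cast this)
  by_cases ht : ∀ g, h.coeff g ≠ 0 → 1 ≤ g.2.2
  · have := map_eq_zero_of_dvd_qhPoly (p := 0) (q := 1) hh h0 hnil hEh fun g hg =>
      ⟨(hh (Finset.mem_coe.2 (Finsupp.mem_support_iff.2 hg))).2.1, by exact_mod_cast ht g hg⟩
    exact Or.inr (by exact_mod_cast this)
  -- now `v` is divisible by `d` and by `r`, so `h` is a polynomial in `s ^ d` and `t ^ r`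
  push Not at hs ht
  obtain ⟨g, hg, hg1⟩ := hs
  obtain ⟨g', hg', hg1'⟩ := ht
  obtain ⟨-, h2, h3, h4⟩ := hh (Finset.mem_coe.2 (Finsupp.mem_support_iff.2 hg))
  obtain ⟨-, h2', h3', h4'⟩ := hh (Finset.mem_coe.2 (Finsupp.mem_support_iff.2 hg'))
  have hcop : IsCoprime (d : ℤ) (r : ℤ) := Nat.isCoprime_iff_coprime.2 hdr
  have hdv : (d : ℤ) ∣ v := by
    rw [← h4, show g.2.1 = 0 by omega]; simp
  have hrv : (r : ℤ) ∣ v := by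
    rw [← h4', show g'.2.2 = 0 by omega]; simp
  have hT : h ∈ supported k k {g : ℤ × ℤ × ℤ | g.1 = 0 ∧ r * g.2.1 + d * g.2.2 = v ∧
      (g.2.1 = 0 ∨ d ≤ g.2.1) ∧ (g.2.2 = 0 ∨ r ≤ g.2.2)} := by
    rw [AddMonoidAlgebra.mem_supported]
    intro g hg
    obtain ⟨h1, h2, h3, h4⟩ := hh hg
    refine ⟨h1, h4, ?_, ?_⟩
    · have : (d : ℤ) ∣ g.2.1 := hcop.dvd_of_dvd_mul_left
        ((dvd_add_left (dvd_mul_right _ _)).1 (h4 ▸ hdv))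
      rcases h2.eq_or_lt with h | h
      · exact Or.inl h.symm
      · exact Or.inr (Int.le_of_dvd h this)
    · have : (r : ℤ) ∣ g.2.2 := hcop.symm.dvd_of_dvd_mul_left
        ((dvd_add_right (dvd_mul_right _ _)).1 (h4 ▸ hrv))
      rcases h3.eq_or_lt with h | h
      · exact Or.inl h.symm
      · exact Or.inr (Int.le_of_dvd h this)
  obtain ⟨a, ha, b, hb, h5, h6⟩ := exists_euler (logDer φ) (by omega) (by omega) hT
  refine map_eq_zero_of_quasiHomogeneous hd hr (hnil (mon_mem_grAlg 0 1 0))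
    (hnil (mon_mem_grAlg 0 0 1)) (hnil (polyST_le_grAlg ha)) (hnil (polyST_le_grAlg hb))
    (mon_ne_zero _ _ _) (mon_ne_zero _ _ _) (h := (v : Laurent k) * h) ?_ ?_ h5 (h6.symm.trans hEh)
  · exact mul_ne_zero (by exact_mod_cast hv) h0
  · simp [hEh]

/-- The bihomogeneous constants of a nonzero bihomogeneous derivation that kills `z` are, up to a
power and a scalar, powers of `z`. -/
theorem exists_pow_eq_of_map_eq_zero (hn : 1 ≤ n) (hne : (n, e) ≠ (1, 0)) (hm : 1 ≤ m)
    (hd : 2 ≤ d) (hr : 2 ≤ r) (hdr : Nat.gcd d r = 1)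
    (hnil : grAlg k n e m d r ≤ nilSubalgebra (logDer φ)) (hφ : φ ≠ 0)
    (hz : logDer φ (grZ k n e m d r) = 0) {w v : ℤ} {u : Laurent k}
    (hu : u ∈ grBipiece k n e m d r w v) (hu0 : u ≠ 0) (hEu : logDer φ u = 0) :
    v * (n * m + e) = w * (d * r * m) ∧
      ∃ c : k, c ≠ 0 ∧ ∃ j : ℕ, u ^ (n * m + e) = c • grZ k n e m d r ^ j := by
  have hM : 0 < n * m + e := by positivity
  rcases lt_or_ge w 0 with hw | hw
  · -- in negative degrees `x` divides `u`, so `x`, `y` and `s ^ d + t ^ r` are constants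
    exfalso
    obtain ⟨u', hu', rfl⟩ := exists_eq_x_mul hw (grBipiece_le_grPiece w v hu)
    have hx : logDer φ (mon k 1 0 0) = 0 :=
      map_eq_zero_of_mul (hnil (mon_mem_grAlg 1 0 0)) (hnil hu') hu0 hEu
    have hy : logDer φ (grY k n d r) = 0 := by
      refine map_eq_zero_of_pow (hnil grY_mem_grAlg) (N := m) (by omega) ?_
      rw [← relation_grZ n e m d r, Derivation.leibniz, Derivation.leibniz_pow, hx, hz]
      simp
    refine hφ (eq_zero_of_map_qhPoly hn hne hm hd hr hdr hnil hz (v := d * r) ?_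
      brieskorn_mem_qhPoly (brieskorn_ne_zero d r) ?_)
    · positivity
    · have : brieskorn k d r = mon k 1 0 0 ^ n * grY k n d r := by
        rw [relation_grY, mon_pow, mon_pow]; simp [brieskorn]
      rw [this, Derivation.leibniz, Derivation.leibniz_pow, hx, hy]
      simp
  · lift w to ℕ using hw
    obtain ⟨h, hh, heq⟩ := exists_eq_grZ_pow_mul hM (pow_mem_grBipiece hu (n * m + e))
    have h0 : grZ k n e m d r ^ w * h ≠ 0 := heq ▸ pow_ne_zero _ hu0
    have hEh : logDer φ h = 0 := by
      refine map_eq_zero_of_mul (hnil (polyST_le_grAlg (qhPoly_le_polyST _ hh)))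
        (hnil (pow_mem grZ_mem_grAlg w)) (mul_comm h _ ▸ h0) ?_
      rw [mul_comm, ← heq, Derivation.leibniz_pow, hEu]
      simp
    have hv : ((n * m + e : ℕ) : ℤ) * v - w * (d * r * m) = 0 := by
      by_contra hv
      exact hφ (eq_zero_of_map_qhPoly hn hne hm hd hr hdr hnil hz hv hh
        (right_ne_zero_of_mul h0) hEh)
    refine ⟨by push_cast at hv; linear_combination hv, ?_⟩
    have hc : h = h.coeff 0 • (1 : Laurent k) := by
      ext g
      by_cases hg : g = 0
      · subst hg; simp [AddMonoidAlgebra.one_def]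
      · have : h.coeff g = 0 := by
          by_contra hne
          obtain ⟨h1, h2, h3, h4⟩ := hh (Finset.mem_coe.2 (Finsupp.mem_support_iff.2 hne))
          rw [hv] at h4
          have h5 : (0 : ℤ) ≤ r * g.2.1 := by positivity
          have h6 : (0 : ℤ) ≤ d * g.2.2 := by positivity
          have h7 : (r : ℤ) * g.2.1 = 0 := by omega
          have h8 : (d : ℤ) * g.2.2 = 0 := by omega
          refine hg (Prod.ext h1 (Prod.ext ?_ ?_))
          · exact (mul_eq_zero.1 h7).resolve_left (by omega)
          · exact (mul_eq_zero.1 h8).resolve_left (by omega)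
        rw [this]
        simp [AddMonoidAlgebra.one_def, Ne.symm hg]
    refine ⟨h.coeff 0, ?_, w, ?_⟩
    · intro h00
      rw [h00, zero_smul] at hc
      exact right_ne_zero_of_mul h0 hc
    · rw [heq]
      nth_rewrite 1 [hc]
      simp

/-- No nonzero bihomogeneous locally nilpotent derivation of the graded ring kills `z`: otherwise
all nonzero elements of the bidegree of `s ^ d` and `t ^ r` have the same degree with respect to the
derivation, while a suitable linear combination of `s ^ d` and `t ^ r` has smaller degree. -/
theorem eq_zero_of_bihomogeneous (hn : 1 ≤ n) (hne : (n, e) ≠ (1, 0)) (hm : 1 ≤ m)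
    (hd : 2 ≤ d) (hr : 2 ≤ r) (hdr : Nat.gcd d r = 1)
    (hnil : grAlg k n e m d r ≤ nilSubalgebra (logDer φ)) {τ τ' : ℤ}
    (hmap : ∀ w v : ℤ, ∀ u ∈ grBipiece k n e m d r w v,
      logDer φ u ∈ grBipiece k n e m d r (w + τ) (v + τ'))
    (hz : logDer φ (grZ k n e m d r) = 0) : φ = 0 := by
  by_contra hφ
  have hiter (N : ℕ) {w v : ℤ} {u : Laurent k} (hu : u ∈ grBipiece k n e m d r w v) :
      (logDer φ)^[N] u ∈ grBipiece k n e m d r (w + N * τ) (v + N * τ') := by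
    induction N with
    | zero => simpa using hu
    | succ N ih =>
      rw [Function.iterate_succ_apply']
      convert hmap _ _ _ ih using 1
      push_cast
      ring_nf
  have hS : mon k 0 d 0 ∈ grBipiece k n e m d r 0 (d * r) := by
    have := mon_eq_grMon (k := k) (n := n) (e := e) (m := m) (d := d) (r := r) 0 d 0
    push_cast at this
    rw [this]
    exact grMon_mem_grBipiece (by simp) (by push_cast; ring)
  have hT : mon k 0 0 r ∈ grBipiece k n e m d r 0 (d * r) := by
    have := mon_eq_grMon (k := k) (n := n) (e := e) (m := m) (d := d) (r := r) 0 0 r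
    push_cast at this
    rw [this]
    exact grMon_mem_grBipiece (by simp) (by push_cast; ring)
  have hmem {u : Laurent k} (hu : u ∈ grBipiece k n e m d r 0 (d * r)) :
      u ∈ nilSubalgebra (logDer φ) := by
    refine hnil ((?_ : grBipiece k n e m d r 0 (d * r) ≤
      Subalgebra.toSubmodule (grAlg k n e m d r)) hu)
    refine Submodule.span_le.2 ?_
    rintro _ ⟨a, b, c, p, q, -, -, rfl⟩
    exact grMon_mem_grAlg a b c p q
  have hker {u : Laurent k} (hu : u ∈ grBipiece k n e m d r 0 (d * r)) (hu0 : u ≠ 0) :=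
    exists_pow_eq_of_map_eq_zero hn hne hm hd hr hdr hnil hφ hz
      (hiter (nilDegree (logDer φ) u) hu) (iterate_nilDegree_ne_zero hu0)
      (map_iterate_nilDegree (hmem hu))
  have hM : (n * m + e : ℤ) ≠ 0 := by positivity
  have hdr0 : (d * r : ℤ) ≠ 0 := by positivity
  -- the degree is determined by the bidegree
  have hdeg {u u' : Laurent k} (hu : u ∈ grBipiece k n e m d r 0 (d * r)) (hu0 : u ≠ 0)
      (hu' : u' ∈ grBipiece k n e m d r 0 (d * r)) (hu0' : u' ≠ 0) :
      nilDegree (logDer φ) u = nilDegree (logDer φ) u' := by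
    obtain ⟨h1, -⟩ := hker hu hu0
    obtain ⟨h2, -⟩ := hker hu' hu0'
    have h3 : (τ * (d * r * m) - τ' * (n * m + e)) ≠ 0 := by
      intro h0
      apply mul_ne_zero hdr0 hM
      linear_combination h1 + nilDegree (logDer φ) u * h0
    have h4 : (nilDegree (logDer φ) u : ℤ) = nilDegree (logDer φ) u' := by
      apply mul_right_cancel₀ h3
      linear_combination h2 - h1
    exact_mod_cast h4
  have haug {u : Laurent k} (hu : u ∈ grBipiece k n e m d r 0 (d * r)) (hu0 : u ≠ 0) :
      augmentation ((logDer φ)^[nilDegree (logDer φ) u] u) ≠ 0 := by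
    obtain ⟨-, c, hc, j, hj⟩ := hker hu hu0
    intro h0
    have := congrArg augmentation hj
    rw [map_pow, h0, zero_pow (by positivity), map_smul, map_pow, smul_eq_mul] at this
    exact mul_ne_zero hc (pow_ne_zero _ (augmentation_grZ_ne_zero n e m d r)) this.symm
  set N := nilDegree (logDer φ) (mon k 0 d 0) with hN
  have hNt : nilDegree (logDer φ) (mon k 0 0 r) = N :=
    hdeg hT (mon_ne_zero _ _ _) hS (mon_ne_zero _ _ _)
  set α := augmentation ((logDer φ)^[N] (mon k 0 d 0))
  set β := augmentation ((logDer φ)^[N] (mon k 0 0 r))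
  have hα : α ≠ 0 := haug hS (mon_ne_zero _ _ _)
  set u := β • mon k 0 d 0 - α • mon k 0 0 r with hu
  have hu0 : u ≠ 0 := by
    intro h0
    have := congrArg (fun h : Laurent k => h.coeff (0, 0, (r : ℤ))) h0
    simp only [hu, mon, AddMonoidAlgebra.coeff_sub, AddMonoidAlgebra.coeff_smul,
      AddMonoidAlgebra.coeff_single, Finsupp.sub_apply, Finsupp.smul_apply, smul_eq_mul,
      AddMonoidAlgebra.coeff_zero, Finsupp.zero_apply, Finsupp.single_eq_same] at this
    rw [Finsupp.single_eq_of_ne (by simp; omega)] at this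
    simp [hα] at this
  have huS : u ∈ grBipiece k n e m d r 0 (d * r) :=
    sub_mem (Submodule.smul_mem _ _ hS) (Submodule.smul_mem _ _ hT)
  apply haug huS hu0
  rw [hdeg huS hu0 hS (mon_ne_zero _ _ _), ← hN, hu, iterate_map_sub, LND.iterate_map_smul,
    LND.iterate_map_smul, map_sub, map_smul, map_smul, smul_eq_mul, smul_eq_mul]
  ring

/-- No nonzero homogeneous locally nilpotent derivation of the graded ring kills `z`. -/
theorem eq_zero_of_homogeneous (hn : 1 ≤ n) (hne : (n, e) ≠ (1, 0)) (hm : 1 ≤ m)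
    (hd : 2 ≤ d) (hr : 2 ≤ r) (hdr : Nat.gcd d r = 1)
    (hnil : grAlg k n e m d r ≤ nilSubalgebra (logDer φ)) {τ : ℤ}
    (hmap : ∀ w : ℤ, ∀ u ∈ grPiece k n e m d r w, logDer φ u ∈ grPiece k n e m d r (w + τ))
    (hz : logDer φ (grZ k n e m d r) = 0) : φ = 0 := by
  by_contra hφ
  obtain ⟨τ', hτ', hne0⟩ := exists_compHom_ne_zero (wtST d r) hφ
  have hcomp {w v : ℤ} {u : Laurent k} (hu : u ∈ grBipiece k n e m d r w v) (N : ℕ) :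
      (logDer (compHom k (wtST d r) τ' φ))^[N] u =
        comp k (wtST d r) (v + N * τ') ((logDer φ)^[N] u) := by
    have h := grBipiece_le_homog w v hu
    rw [comp_iterate_logDer hτ' (homog_le_degLE _ _ h), comp_eq_self h]
  have hnilmon (a b c p q : ℕ) : grMon k n e m d r a b c p q ∈
      nilSubalgebra (logDer (compHom k (wtST d r) τ' φ)) := by
    obtain ⟨N, hN⟩ := hnil (grMon_mem_grAlg a b c p q)
    exact ⟨N, by rw [hcomp (grMon_mem_grBipiece rfl rfl), hN, map_zero]⟩
  refine hne0 (eq_zero_of_bihomogeneous hn hne hm hd hr hdr ?_ (τ := τ) (τ' := τ') ?_ ?_)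
  · refine Algebra.adjoin_le ?_
    rintro _ (rfl | rfl | rfl | rfl | rfl)
    · simpa [grMon] using hnilmon 1 0 0 0 0
    · simpa [grMon, mon_zero] using hnilmon 0 1 0 0 0
    · simpa [grMon, mon_zero] using hnilmon 0 0 1 0 0
    · simpa [grMon] using hnilmon 0 0 0 1 0
    · simpa [grMon] using hnilmon 0 0 0 0 1
  · intro w v u hu
    have := hcomp hu 1
    simp only [Function.iterate_one, Nat.cast_one, one_mul] at this
    rw [this]
    exact comp_mem_grBipiece (hmap w u (grBipiece_le_grPiece w v hu))
  · have h1 : grZ k n e m d r ∈ grBipiece k n e m d r (n * m + e) (d * r * m) := by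
      rw [grZ_eq_grMon]
      exact grMon_mem_grBipiece (by simp) (by simp)
    have := hcomp h1 1
    simp only [Function.iterate_one, hz, map_zero] at this
    exact this

end Bihomogeneous

/-! ### The embedding of `B` into the Laurent polynomials -/

noncomputable section Embedding

variable {k : Type*} [Field k]

/-- The substitution of the Laurent monomials `x, s, t` into polynomials in three variables. -/
def evalXST : MvPolynomial (Fin 3) k →ₐ[k] Laurent k :=
  aeval ![mon k 1 0 0, mon k 0 1 0, mon k 0 0 1]

theorem evalXST_monomial (α : Fin 3 →₀ ℕ) (c : k) :
    evalXST (monomial α c) = AddMonoidAlgebra.single ((α 0 : ℤ), (α 1 : ℤ), (α 2 : ℤ)) c := by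
  rw [evalXST, aeval_monomial, Finsupp.prod_fintype _ _ (by simp), Fin.prod_univ_three]
  simp [mon, AddMonoidAlgebra.single_pow, AddMonoidAlgebra.single_mul_single]

theorem evalXST_injective : Function.Injective (evalXST (k := k)) := by
  rw [injective_iff_map_eq_zero]
  intro P hP
  have h (α : Fin 3 →₀ ℕ) :
      (evalXST P).coeff ((α 0 : ℤ), (α 1 : ℤ), (α 2 : ℤ)) = P.coeff α := by
    clear hP
    induction P using MvPolynomial.induction_on' with
    | monomial β c =>
      rw [evalXST_monomial, coeff_monomial, AddMonoidAlgebra.coeff_single, Finsupp.single_apply]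
      refine if_congr ?_ rfl rfl
      simp only [Prod.mk.injEq, Nat.cast_inj, Finsupp.ext_iff, Fin.forall_fin_succ]
      simp
    | add P Q hP hQ => simp [hP, hQ]
  ext α
  rw [← h α, hP]
  simp

theorem evalXST_mem_degLE (P : MvPolynomial (Fin 3) k) : evalXST P ∈ degLE k wtX 0 := by
  induction P using MvPolynomial.induction_on' with
  | monomial β c =>
    rw [evalXST_monomial]
    exact single_mem_supported (by simp [wtX_apply]) c
  | add P Q hP hQ => rw [map_add]; exact add_mem hP hQ

variable (n e m d r : ℕ) (Q : MvPolynomial (Fin 3) k)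

/-- The image `s ^ d + t ^ r + x Q(x, s, t)` of `x ^ n y`. -/
def embF : Laurent k := brieskorn k d r + mon k 1 0 0 * evalXST Q

/-- The image of `y`. -/
def embY : Laurent k := mon k (-n) 0 0 * embF d r Q

/-- The image of `z`. -/
def embZ : Laurent k := mon k (-e) 0 0 * (embY n d r Q ^ m - mon k 0 1 0)

theorem relation_embY : mon k 1 0 0 ^ n * embY n d r Q =
    mon k 0 1 0 ^ d + mon k 0 0 1 ^ r + mon k 1 0 0 * evalXST Q := by
  rw [embY, ← mul_assoc, mon_pow, mon_mul_mon, mon_pow, mon_pow]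
  simp [mon_zero, brieskorn, embF]

theorem relation_embZ :
    mon k 1 0 0 ^ e * embZ n e m d r Q = embY n d r Q ^ m - mon k 0 1 0 := by
  rw [embZ, ← mul_assoc, mon_pow, mon_mul_mon]
  simp [mon_zero]

/-- The homomorphism from `B` to the Laurent polynomials that maps `x, s, t` to `x, s, t`. -/
def emb : B n e m d r Q →ₐ[k] Laurent k :=
  Ideal.Quotient.liftₐ _ (aeval ![mon k 1 0 0, embY n d r Q, embZ n e m d r Q, mon k 0 0 1]) <| by
    intro a ha
    obtain ⟨b, rfl⟩ := Ideal.mem_span_singleton'.1 ha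
    rw [map_mul]
    refine mul_eq_zero_of_right _ ?_
    have h0 := relation_embZ n e m d r Q
    have h1 := relation_embY n d r Q
    rw [relation, map_sub, map_sub, map_sub, map_mul, map_mul]
    have h2 : embY n d r Q ^ m - mon k 1 0 0 ^ e * embZ n e m d r Q = mon k 0 1 0 := by
      rw [h0]; ring
    have h3 : aeval ![mon k 1 0 0, embY n d r Q, embZ n e m d r Q, mon k 0 0 1]
        ((aeval ![X 0, X 1 ^ m - X 0 ^ e * X 2, X 3] : MvPolynomial (Fin 3) k →ₐ[k]
          MvPolynomial (Fin 4) k) Q) = evalXST Q := by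
      rw [← AlgHom.comp_apply]
      refine DFunLike.congr_fun (MvPolynomial.algHom_ext (fun i => ?_)) Q
      fin_cases i <;> simp [evalXST, h2]
    rw [h3]
    simp only [map_pow, map_sub, map_mul, aeval_X, Matrix.cons_val, h2, h1]
    ring

theorem emb_mk (P : MvPolynomial (Fin 4) k) : emb n e m d r Q (Ideal.Quotient.mk _ P) =
    aeval ![mon k 1 0 0, embY n d r Q, embZ n e m d r Q, mon k 0 0 1] P := rfl

theorem emb_x : emb n e m d r Q (x n e m d r Q) = mon k 1 0 0 := by
  simp [x, emb_mk]

theorem emb_y : emb n e m d r Q (y n e m d r Q) = embY n d r Q := by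
  simp [y, emb_mk]

theorem emb_z : emb n e m d r Q (z n e m d r Q) = embZ n e m d r Q := by
  simp [z, emb_mk]

theorem emb_t : emb n e m d r Q (t n e m d r Q) = mon k 0 0 1 := by
  simp [t, emb_mk]

theorem emb_s : emb n e m d r Q (s n e m d r Q) = mon k 0 1 0 := by
  rw [s, map_sub, map_mul, map_pow, map_pow, emb_x, emb_y, emb_z, relation_embZ]
  ring

/-- The substitution of `x, s, t` into polynomials in three variables. -/
def polyXST : MvPolynomial (Fin 3) k →ₐ[k] B n e m d r Q :=
  aeval ![x n e m d r Q, s n e m d r Q, t n e m d r Q]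

theorem emb_polyXST (P : MvPolynomial (Fin 3) k) :
    emb n e m d r Q (polyXST n e m d r Q P) = evalXST P := by
  rw [← AlgHom.comp_apply]
  refine DFunLike.congr_fun (MvPolynomial.algHom_ext (fun i => ?_)) P
  fin_cases i <;> simp [evalXST, polyXST, emb_x, emb_s, emb_t]

theorem relation_y : x n e m d r Q ^ n * y n e m d r Q =
    s n e m d r Q ^ d + t n e m d r Q ^ r + x n e m d r Q * polyXST n e m d r Q Q := by
  have h1 : polyXST n e m d r Q Q = Ideal.Quotient.mk (Ideal.span {relation n e m d r Q})
      (aeval ![X 0, X 1 ^ m - X 0 ^ e * X 2, X 3] Q) := by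
    rw [← Ideal.Quotient.mkₐ_eq_mk k, ← AlgHom.comp_apply]
    refine DFunLike.congr_fun (MvPolynomial.algHom_ext (fun i => ?_)) Q
    fin_cases i <;> simp [polyXST, x, s, t, y, z]
  have h2 : Ideal.Quotient.mk (Ideal.span {relation n e m d r Q}) (X 0 ^ n * X 1 -
      (X 1 ^ m - X 0 ^ e * X 2) ^ d - X 3 ^ r -
      X 0 * aeval ![X 0, X 1 ^ m - X 0 ^ e * X 2, X 3] Q) = 0 :=
    Ideal.Quotient.eq_zero_iff_mem.2 (Ideal.mem_span_singleton_self _)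
  rw [h1]
  simp only [map_sub, map_mul, map_pow] at h2
  simp only [x, s, t, y, z]
  linear_combination h2

theorem relation_z : x n e m d r Q ^ e * z n e m d r Q =
    y n e m d r Q ^ m - s n e m d r Q := by
  rw [s]; ring

theorem adjoin_eq_top : Algebra.adjoin k
    ({x n e m d r Q, y n e m d r Q, z n e m d r Q, t n e m d r Q} : Set (B n e m d r Q)) = ⊤ := by
  rw [eq_top_iff]
  rintro b -
  obtain ⟨P, rfl⟩ := Ideal.Quotient.mk_surjective b
  induction P using MvPolynomial.induction_on with
  | C c => exact Subalgebra.algebraMap_mem _ c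
  | add P P' h h' => rw [map_add]; exact add_mem h h'
  | mul_X P i h =>
    rw [map_mul]
    refine mul_mem h (Algebra.subset_adjoin ?_)
    fin_cases i <;> simp [x, y, z, t]

/-- `x` is not a zero divisor of `B`, since `X` does not divide the relation. -/
theorem eq_zero_of_x_mul_eq_zero (hm : m ≠ 0) (hd : d ≠ 0) (hn : n ≠ 0) {b : B n e m d r Q}
    (h : x n e m d r Q * b = 0) : b = 0 := by
  obtain ⟨P, rfl⟩ := Ideal.Quotient.mk_surjective b
  rw [x, ← map_mul, Ideal.Quotient.eq_zero_iff_mem, Ideal.mem_span_singleton'] at h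
  obtain ⟨R, hR⟩ := h
  have hprime : Prime (X 0 : MvPolynomial (Fin 4) k) := X_prime
  have h1 : (X 0 : MvPolynomial (Fin 4) k) ∣ R * relation n e m d r Q := ⟨P, hR⟩
  rcases hprime.dvd_or_dvd h1 with ⟨R', rfl⟩ | ⟨R', hR'⟩
  · refine Ideal.Quotient.eq_zero_iff_mem.2 (Ideal.mem_span_singleton'.2 ⟨R', ?_⟩)
    exact mul_left_cancel₀ hprime.ne_zero (by rw [← hR]; ring)
  · -- at the point `(0, 0, 0, 1)` the relation has the value `-1`
    exfalso
    have h2 := congrArg (MvPolynomial.eval ![(0 : k), 0, 0, 1]) hR'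
    simp [relation, hm, hd, hn] at h2

theorem exists_x_pow_mul_eq (b : B n e m d r Q) :
    ∃ N : ℕ, ∃ P, x n e m d r Q ^ N * b = polyXST n e m d r Q P := by
  have hb : b ∈ Algebra.adjoin k
    ({x n e m d r Q, y n e m d r Q, z n e m d r Q, t n e m d r Q} : Set (B n e m d r Q)) := by
    rw [adjoin_eq_top]; trivial
  have hx : x n e m d r Q = polyXST n e m d r Q (X 0) := by simp [polyXST]
  have hs : s n e m d r Q = polyXST n e m d r Q (X 1) := by simp [polyXST]
  have ht : t n e m d r Q = polyXST n e m d r Q (X 2) := by simp [polyXST]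
  have hy : x n e m d r Q ^ n * y n e m d r Q =
      polyXST n e m d r Q (X 1 ^ d + X 2 ^ r + X 0 * Q) := by
    rw [relation_y]; simp only [map_add, map_mul, map_pow, ← hx, ← hs, ← ht]
  induction hb using Algebra.adjoin_induction with
  | mem b hb =>
    rcases hb with rfl | rfl | rfl | rfl
    · exact ⟨0, X 0, by rw [pow_zero, one_mul, hx]⟩
    · exact ⟨n, _, hy⟩
    · refine ⟨n * m + e, (X 1 ^ d + X 2 ^ r + X 0 * Q) ^ m - X 0 ^ (n * m) * X 1, ?_⟩
      rw [pow_add, mul_assoc, relation_z, map_sub, map_pow, ← hy, map_mul, map_pow, ← hx, ← hs]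
      ring
    · exact ⟨0, X 2, by rw [pow_zero, one_mul, ht]⟩
  | algebraMap c => exact ⟨0, C c, by rw [pow_zero, one_mul, ← algebraMap_eq, AlgHom.commutes]⟩
  | add b b' _ _ h h' =>
    obtain ⟨N, P, hP⟩ := h
    obtain ⟨N', P', hP'⟩ := h'
    refine ⟨N + N', X 0 ^ N' * P + X 0 ^ N * P', ?_⟩
    simp only [map_add, map_mul, map_pow, ← hP, ← hP', ← hx]
    ring
  | mul b b' _ _ h h' =>
    obtain ⟨N, P, hP⟩ := h
    obtain ⟨N', P', hP'⟩ := h'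
    refine ⟨N + N', P * P', ?_⟩
    simp only [map_mul, ← hP, ← hP']
    ring

/-- Multiplication by a power of `x`, which is not a zero divisor, turns an element of `B` into a
polynomial in `x, s, t`, and these are algebraically independent in the Laurent polynomials. -/
theorem emb_injective (hm : m ≠ 0) (hd : d ≠ 0) (hn : n ≠ 0) :
    Function.Injective (emb n e m d r Q) := by
  rw [injective_iff_map_eq_zero]
  intro b hb
  obtain ⟨N, P, hP⟩ := exists_x_pow_mul_eq n e m d r Q b
  have h1 : evalXST P = 0 := by rw [← emb_polyXST n e m d r Q, ← hP, map_mul, hb, mul_zero]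
  rw [evalXST_injective (h1.trans (map_zero _).symm), map_zero] at hP
  induction N with
  | zero => simpa using hP
  | succ N ih =>
    rw [pow_succ', mul_assoc] at hP
    exact ih (eq_zero_of_x_mul_eq_zero n e m d r Q hm hd hn hP)

theorem isDomain_B (hm : m ≠ 0) (hd : d ≠ 0) (hn : n ≠ 0) : IsDomain (B n e m d r Q) :=
  (emb_injective n e m d r Q hm hd hn).isDomain (emb n e m d r Q).toRingHom

/-! ### The filtration of `B` -/

/-- The monomial `x ^ a y ^ b z ^ c s ^ p t ^ q` of `B`. -/
def monB (a b c p q : ℕ) : B n e m d r Q :=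
  x n e m d r Q ^ a * y n e m d r Q ^ b * z n e m d r Q ^ c * s n e m d r Q ^ p * t n e m d r Q ^ q

theorem monB_mul (a b c p q a' b' c' p' q' : ℕ) :
    monB n e m d r Q a b c p q * monB n e m d r Q a' b' c' p' q' =
      monB n e m d r Q (a + a') (b + b') (c + c') (p + p') (q + q') := by
  simp only [monB, pow_add]
  ring

/-- The span of the monomials of weight at most `w`. -/
def fil (w : ℤ) : Submodule k (B n e m d r Q) :=
  Submodule.span k {u | ∃ a b c p q : ℕ, -(a : ℤ) + n * b + (n * m + e) * c ≤ w ∧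
    monB n e m d r Q a b c p q = u}

variable {n e m d r Q}

theorem monB_mem_fil {a b c p q : ℕ} {w : ℤ} (h : -(a : ℤ) + n * b + (n * m + e) * c ≤ w) :
    monB n e m d r Q a b c p q ∈ fil n e m d r Q w :=
  Submodule.subset_span ⟨a, b, c, p, q, h, rfl⟩

theorem fil_mono {w w' : ℤ} (h : w ≤ w') : fil n e m d r Q w ≤ fil n e m d r Q w' := by
  refine Submodule.span_mono ?_
  rintro _ ⟨a, b, c, p, q, hw, rfl⟩
  exact ⟨a, b, c, p, q, hw.trans h, rfl⟩

theorem mul_mem_fil {w w' : ℤ} {u u' : B n e m d r Q} (hu : u ∈ fil n e m d r Q w)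
    (hu' : u' ∈ fil n e m d r Q w') : u * u' ∈ fil n e m d r Q (w + w') := by
  have : u * u' ∈ fil n e m d r Q w * fil n e m d r Q w' := Submodule.mul_mem_mul hu hu'
  rw [fil, fil, Submodule.span_mul_span] at this
  refine Submodule.span_mono ?_ this
  rintro _ ⟨_, ⟨a, b, c, p, q, h, rfl⟩, _, ⟨a', b', c', p', q', h', rfl⟩, rfl⟩
  refine ⟨_, _, _, _, _, ?_, (monB_mul ..).symm⟩
  push_cast
  linarith

theorem exists_mem_fil (u : B n e m d r Q) : ∃ w, u ∈ fil n e m d r Q w := by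
  have hu : u ∈ Algebra.adjoin k
    ({x n e m d r Q, y n e m d r Q, z n e m d r Q, t n e m d r Q} : Set (B n e m d r Q)) := by
    rw [adjoin_eq_top]; trivial
  have h (a b c q : ℕ) : monB n e m d r Q a b c 0 q ∈
      fil n e m d r Q (-(a : ℤ) + n * b + (n * m + e) * c) := monB_mem_fil le_rfl
  induction hu using Algebra.adjoin_induction with
  | mem u hu =>
    rcases hu with rfl | rfl | rfl | rfl
    · exact ⟨_, by simpa [monB] using h 1 0 0 0⟩
    · exact ⟨_, by simpa [monB] using h 0 1 0 0⟩
    · exact ⟨_, by simpa [monB] using h 0 0 1 0⟩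
    · exact ⟨_, by simpa [monB] using h 0 0 0 1⟩
  | algebraMap c =>
    refine ⟨0, ?_⟩
    rw [Algebra.algebraMap_eq_smul_one]
    refine Submodule.smul_mem _ _ ?_
    simpa [monB] using monB_mem_fil (n := n) (e := e) (m := m) (d := d) (r := r) (Q := Q)
      (a := 0) (b := 0) (c := 0) (p := 0) (q := 0) (w := 0) (by simp)
  | add u u' _ _ h h' =>
    obtain ⟨w, h⟩ := h
    obtain ⟨w', h'⟩ := h'
    exact ⟨max w w', add_mem (fil_mono (le_max_left _ _) h) (fil_mono (le_max_right _ _) h')⟩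
  | mul u u' _ _ h h' =>
    obtain ⟨w, h⟩ := h
    obtain ⟨w', h'⟩ := h'
    exact ⟨w + w', mul_mem_fil h h'⟩

end Embedding

/-! ### Leading forms of the elements of `B` -/

noncomputable section Filtration

variable {k : Type*} [Field k] {n e m d r : ℕ} {Q : MvPolynomial (Fin 3) k}

theorem comp_pow {w : ℤ × ℤ × ℤ →+ ℤ} {i : ℤ} {a : Laurent k} (ha : a ∈ degLE k w i) (N : ℕ) :
    a ^ N ∈ degLE k w (N * i) ∧ comp k w (N * i) (a ^ N) = comp k w i a ^ N := by
  induction N with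
  | zero =>
    have h : (1 : Laurent k) ∈ homog k w 0 := one_mem_homog w
    simp only [pow_zero, Nat.cast_zero, zero_mul]
    exact ⟨homog_le_degLE _ _ h, comp_eq_self h⟩
  | succ N ih =>
    have h : ((N + 1 : ℕ) : ℤ) * i = N * i + i := by push_cast; ring
    rw [h, pow_succ, pow_succ, comp_mul ih.1 ha, ih.2]
    exact ⟨mul_mem_degLE ih.1 ha, rfl⟩

theorem embF_mem (d r : ℕ) (Q : MvPolynomial (Fin 3) k) :
    embF d r Q ∈ degLE k wtX 0 ∧ comp k wtX 0 (embF d r Q) = brieskorn k d r := by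
  have h1 : mon k 1 0 0 * evalXST Q ∈ degLE k wtX (0 - 1) := by
    convert mul_mem_degLE (homog_le_degLE _ _ (mon_mem_homog_wtX rfl)) (evalXST_mem_degLE Q) using 2
    norm_num
  have h2 := brieskorn_mem_homog_wtX (k := k) d r
  constructor
  · exact add_mem (homog_le_degLE _ _ h2) (degLE_mono _ (by omega) h1)
  · rw [embF, map_add, comp_eq_zero h1, comp_eq_self h2, add_zero]

theorem embY_mem (n d r : ℕ) (Q : MvPolynomial (Fin 3) k) :
    embY n d r Q ∈ degLE k wtX n ∧ comp k wtX n (embY n d r Q) = grY k n d r := by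
  have h1 : mon k (-n) 0 0 ∈ homog k wtX n := mon_mem_homog_wtX (by simp)
  have h2 := comp_mul (homog_le_degLE _ _ h1) (embF_mem d r Q).1
  have h3 := mul_mem_degLE (homog_le_degLE _ _ h1) (embF_mem d r Q).1
  rw [comp_eq_self h1, (embF_mem d r Q).2, add_zero] at h2
  rw [add_zero] at h3
  exact ⟨h3, h2⟩

theorem embZ_mem (hn : 1 ≤ n) (hm : 1 ≤ m) (e d r : ℕ) (Q : MvPolynomial (Fin 3) k) :
    embZ n e m d r Q ∈ degLE k wtX (n * m + e) ∧
      comp k wtX (n * m + e) (embZ n e m d r Q) = grZ k n e m d r := by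
  have h1 : mon k (-e) 0 0 ∈ homog k wtX e := mon_mem_homog_wtX (by simp)
  obtain ⟨h2, h3⟩ := comp_pow (embY_mem n d r Q).1 m
  have h4 : mon k 0 1 0 ∈ degLE k wtX (m * n - 1) := by
    refine degLE_mono _ ?_ (homog_le_degLE _ _ (mon_mem_homog_wtX (neg_zero)))
    have : (0 : ℤ) < m * n := by positivity
    omega
  have h5 : embY n d r Q ^ m - mon k 0 1 0 ∈ degLE k wtX (m * n) :=
    sub_mem h2 (degLE_mono _ (by omega) h4)
  have h6 := comp_mul (homog_le_degLE _ _ h1) h5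
  have h7 := mul_mem_degLE (homog_le_degLE _ _ h1) h5
  have h8 : (e + m * n : ℤ) = n * m + e := by ring
  rw [h8] at h6 h7
  refine ⟨h7, h6.trans ?_⟩
  rw [map_sub, comp_eq_zero h4, h3, comp_eq_self h1, (embY_mem n d r Q).2, sub_zero, grY, grZ,
    mul_pow, mon_pow, ← mul_assoc, mon_mul_mon]
  congr 2
  · ring

theorem emb_monB_mem (hn : 1 ≤ n) (hm : 1 ≤ m) (a b c p q : ℕ) :
    emb n e m d r Q (monB n e m d r Q a b c p q) ∈
        degLE k wtX (-(a : ℤ) + n * b + (n * m + e) * c) ∧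
      comp k wtX (-(a : ℤ) + n * b + (n * m + e) * c)
        (emb n e m d r Q (monB n e m d r Q a b c p q)) = grMon k n e m d r a b c p q := by
  have h1 : mon k a p q ∈ homog k wtX (-a) := mon_mem_homog_wtX rfl
  obtain ⟨h2, h2'⟩ := comp_pow (embY_mem n d r Q).1 b
  obtain ⟨h3, h3'⟩ := comp_pow (embZ_mem hn hm e d r Q).1 c
  have h4 := mul_mem_degLE (homog_le_degLE _ _ h1) h2
  have h4' := comp_mul (homog_le_degLE _ _ h1) h2
  have h5 := mul_mem_degLE h4 h3
  have h5' := comp_mul h4 h3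
  rw [h4', h2', h3', comp_eq_self h1, (embY_mem n d r Q).2, (embZ_mem hn hm e d r Q).2] at h5'
  have h6 : emb n e m d r Q (monB n e m d r Q a b c p q) =
      mon k a p q * embY n d r Q ^ b * embZ n e m d r Q ^ c := by
    have : mon k a p q = mon k 1 0 0 ^ a * mon k 0 1 0 ^ p * mon k 0 0 1 ^ q := by
      simp [mon_pow, mon_mul_mon]
    rw [this]
    simp only [monB, map_mul, map_pow, emb_x, emb_y, emb_z, emb_s, emb_t]
    ring
  have h7 : (-a + b * n + c * (n * m + e) : ℤ) = -(a : ℤ) + n * b + (n * m + e) * c := by ring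
  rw [h6, ← h7]
  exact ⟨h5, h5'⟩

theorem emb_mem_degLE (hn : 1 ≤ n) (hm : 1 ≤ m) {w : ℤ} {u : B n e m d r Q}
    (hu : u ∈ fil n e m d r Q w) : emb n e m d r Q u ∈ degLE k wtX w := by
  suffices fil n e m d r Q w ≤ (degLE k wtX w).comap (emb n e m d r Q).toLinearMap from this hu
  refine Submodule.span_le.2 ?_
  rintro _ ⟨a, b, c, p, q, hw, rfl⟩
  exact degLE_mono _ hw (emb_monB_mem hn hm a b c p q).1

/-- The leading forms of `B` lie in the graded ring. -/
theorem comp_emb_mem_grPiece (hn : 1 ≤ n) (hm : 1 ≤ m) {w : ℤ} {u : B n e m d r Q}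
    (hu : u ∈ fil n e m d r Q w) : comp k wtX w (emb n e m d r Q u) ∈ grPiece k n e m d r w := by
  suffices fil n e m d r Q w ≤
    (grPiece k n e m d r w).comap ((comp k wtX w).comp (emb n e m d r Q).toLinearMap) from this hu
  refine Submodule.span_le.2 ?_
  rintro _ ⟨a, b, c, p, q, hw, rfl⟩
  obtain ⟨h1, h2⟩ := emb_monB_mem (k := k) (Q := Q) (d := d) (r := r) (e := e) hn hm a b c p q
  rw [SetLike.mem_coe, Submodule.mem_comap, LinearMap.comp_apply, AlgHom.toLinearMap_apply]
  rcases hw.lt_or_eq with hw | hw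
  · rw [comp_eq_zero (degLE_mono _ (by omega) h1)]
    exact zero_mem _
  · rw [← hw, h2]
    exact grMon_mem_grPiece rfl

/-- Every homogeneous element of the graded ring is a leading form. -/
theorem exists_comp_emb_eq (hn : 1 ≤ n) (hm : 1 ≤ m) {w : ℤ} {a : Laurent k}
    (ha : a ∈ grPiece k n e m d r w) :
    ∃ u ∈ fil n e m d r Q w, comp k wtX w (emb n e m d r Q u) = a := by
  suffices grPiece k n e m d r w ≤ (fil n e m d r Q w).map
    ((comp k wtX w).comp (emb n e m d r Q).toLinearMap) from this ha
  refine Submodule.span_le.2 ?_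
  rintro _ ⟨a, b, c, p, q, rfl, rfl⟩
  exact ⟨_, monB_mem_fil le_rfl, (emb_monB_mem hn hm a b c p q).2⟩

theorem mul_pow_sub_mem_fil {i j : ℤ} {a b u : B n e m d r Q} (ha : a ∈ fil n e m d r Q i)
    (hb : b ∈ fil n e m d r Q i) (hab : a - b ∈ fil n e m d r Q (i - 1))
    (hu : u ∈ fil n e m d r Q j) (N : ℕ) :
    u * a ^ N - u * b ^ N ∈ fil n e m d r Q (j + N * i - 1) := by
  induction N generalizing u j with
  | zero => simp
  | succ N ih =>
    have h1 := ih (mul_mem_fil hu ha)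
    have h2 : u * b ^ N ∈ fil n e m d r Q (j + N * i) := by
      clear ih h1
      induction N with
      | zero => simpa using hu
      | succ N ih =>
        rw [pow_succ, ← mul_assoc]
        convert mul_mem_fil ih hb using 1
        push_cast
        ring_nf
    have h3 := mul_mem_fil h2 hab
    have h4 : u * a ^ (N + 1) - u * b ^ (N + 1) =
        (u * a * a ^ N - u * a * b ^ N) + u * b ^ N * (a - b) := by ring
    rw [h4]
    refine add_mem ?_ ?_
    · convert h1 using 1; push_cast; ring_nf
    · convert h3 using 1; push_cast; ring_nf

theorem polyXST_mem_fil (P : MvPolynomial (Fin 3) k) :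
    polyXST n e m d r Q P ∈ fil n e m d r Q 0 := by
  induction P using MvPolynomial.induction_on' with
  | monomial β c =>
    rw [polyXST, aeval_monomial, Finsupp.prod_fintype _ _ (by simp), Fin.prod_univ_three,
      ← Algebra.smul_def]
    refine Submodule.smul_mem _ _ ?_
    have := monB_mem_fil (n := n) (e := e) (m := m) (d := d) (r := r) (Q := Q)
      (a := β 0) (b := 0) (c := 0) (p := β 1) (q := β 2) (w := 0) (by simp)
    simpa [monB] using this
  | add P Q hP hQ => rw [map_add]; exact add_mem hP hQ

variable (n e m d r Q) in
/-- The element `s ^ d + t ^ r` of `B`. -/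
def brieskornB : B n e m d r Q := s n e m d r Q ^ d + t n e m d r Q ^ r

/-- Up to terms of lower weight, two monomials in `x, y, z` of the same weight differ by a power of
`s ^ d + t ^ r`: if `z` occurs in different powers, `x ^ e z` is exchanged for `y ^ m`, and the
remaining factors `x ^ n y` are replaced by `s ^ d + t ^ r`. -/
theorem monB_sub_mem_fil (hn : 1 ≤ n) (hm : 1 ≤ m) {a b c a₀ b₀ c₀ j : ℕ}
    (h : -(a : ℤ) + n * b + (n * m + e) * c = -(a₀ : ℤ) + n * b₀ + (n * m + e) * c₀)
    (hj : b + m * c = b₀ + m * c₀ + j) :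
    monB n e m d r Q a b c 0 0 - monB n e m d r Q a₀ b₀ c₀ 0 0 * brieskornB n e m d r Q ^ j ∈
      fil n e m d r Q (-(a₀ : ℤ) + n * b₀ + (n * m + e) * c₀ - 1) := by
  have ha : (a : ℤ) = a₀ + n * j + e * (c - c₀) := by
    have hj' : (b + m * c : ℤ) = b₀ + m * c₀ + j := by exact_mod_cast hj
    linear_combination n * hj' - h
  have hx : x n e m d r Q ^ n * y n e m d r Q ∈ fil n e m d r Q 0 := by
    simpa [monB] using monB_mem_fil (n := n) (e := e) (m := m) (d := d) (r := r) (Q := Q)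
      (a := n) (b := 1) (c := 0) (p := 0) (q := 0) (w := 0) (by simp)
  have hxz : x n e m d r Q ^ e * z n e m d r Q ∈ fil n e m d r Q (n * m) := by
    simpa [monB] using monB_mem_fil (n := n) (e := e) (m := m) (d := d) (r := r) (Q := Q)
      (a := e) (b := 0) (c := 1) (p := 0) (q := 0) (w := n * m) (by push_cast; linarith)
  have hym : y n e m d r Q ^ m ∈ fil n e m d r Q (n * m) := by
    simpa [monB] using monB_mem_fil (n := n) (e := e) (m := m) (d := d) (r := r) (Q := Q)
      (a := 0) (b := m) (c := 0) (p := 0) (q := 0) (w := n * m) (by simp)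
  have hf : brieskornB n e m d r Q ∈ fil n e m d r Q 0 := by
    refine add_mem ?_ ?_
    · simpa [monB] using monB_mem_fil (n := n) (e := e) (m := m) (d := d) (r := r) (Q := Q)
        (a := 0) (b := 0) (c := 0) (p := d) (q := 0) (w := 0) (by simp)
    · simpa [monB] using monB_mem_fil (n := n) (e := e) (m := m) (d := d) (r := r) (Q := Q)
        (a := 0) (b := 0) (c := 0) (p := 0) (q := r) (w := 0) (by simp)
  have h1 : x n e m d r Q ^ n * y n e m d r Q - brieskornB n e m d r Q ∈
      fil n e m d r Q (0 - 1) := by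
    rw [relation_y, brieskornB, add_sub_cancel_left]
    have := monB_mem_fil (n := n) (e := e) (m := m) (d := d) (r := r) (Q := Q)
      (a := 1) (b := 0) (c := 0) (p := 0) (q := 0) (w := -1) (by simp)
    simpa [monB] using mul_mem_fil this (polyXST_mem_fil Q)
  have h2 : x n e m d r Q ^ e * z n e m d r Q - y n e m d r Q ^ m ∈
      fil n e m d r Q (n * m - 1) := by
    rw [relation_z, sub_sub_cancel_left]
    refine neg_mem (fil_mono (w := 0) ?_ ?_)
    · have : (0 : ℤ) < n * m := by positivity
      omega
    · simpa [monB] using monB_mem_fil (n := n) (e := e) (m := m) (d := d) (r := r) (Q := Q)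
        (a := 0) (b := 0) (c := 0) (p := 1) (q := 0) (w := 0) (by simp)
  have h3 : monB n e m d r Q (a₀ + n * j) (b₀ + j) c₀ 0 0 -
      monB n e m d r Q a₀ b₀ c₀ 0 0 * brieskornB n e m d r Q ^ j ∈
      fil n e m d r Q (-(a₀ : ℤ) + n * b₀ + (n * m + e) * c₀ - 1) := by
    convert mul_pow_sub_mem_fil hx hf h1 (monB_mem_fil (a := a₀) (b := b₀) (c := c₀) (p := 0)
      (q := 0) le_rfl) j using 1
    · ring_nf
    · simp only [monB, pow_add, pow_mul, mul_pow]; ring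
  suffices h4 : monB n e m d r Q a b c 0 0 - monB n e m d r Q (a₀ + n * j) (b₀ + j) c₀ 0 0 ∈
      fil n e m d r Q (-(a₀ : ℤ) + n * b₀ + (n * m + e) * c₀ - 1) by
    simpa using add_mem h4 h3
  rcases le_total c₀ c with hc | hc
  · obtain ⟨l, rfl⟩ := Nat.exists_eq_add_of_le hc
    obtain rfl : a = a₀ + n * j + e * l := by zify; rw [ha]; push_cast; ring
    obtain hb : b₀ + j = b + m * l := by rw [mul_add] at hj; omega
    convert mul_pow_sub_mem_fil hxz hym h2 (monB_mem_fil (a := a₀ + n * j) (b := b) (c := c₀)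
      (p := 0) (q := 0) le_rfl) l using 1
    · congr 1
      rw [← h]; push_cast; ring
    · rw [hb]
      simp only [monB, pow_add, pow_mul, mul_pow]; ring
  · obtain ⟨l, rfl⟩ := Nat.exists_eq_add_of_le hc
    obtain ha' : a₀ + n * j = a + e * l := by zify; rw [ha]; push_cast; ring
    obtain rfl : b = b₀ + j + m * l := by rw [mul_add] at hj; omega
    convert neg_mem (mul_pow_sub_mem_fil hxz hym h2 (monB_mem_fil (a := a) (b := b₀ + j) (c := c)
      (p := 0) (q := 0) le_rfl) l) using 1
    · congr 1
      rw [← h]; push_cast; ring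
    · rw [ha']
      simp only [monB, pow_add, pow_mul, mul_pow]; ring

theorem emb_mem_homog_of_mem_adjoin {u : B n e m d r Q}
    (hu : u ∈ Algebra.adjoin k {s n e m d r Q, t n e m d r Q}) :
    emb n e m d r Q u ∈ homog k wtX 0 := by
  induction hu using Algebra.adjoin_induction with
  | mem u hu =>
    rcases hu with rfl | rfl
    · rw [emb_s]; exact mon_mem_homog_wtX neg_zero
    · rw [emb_t]; exact mon_mem_homog_wtX neg_zero
  | algebraMap c =>
    rw [AlgHom.commutes, Algebra.algebraMap_eq_smul_one]
    exact Submodule.smul_mem _ _ (one_mem_homog _)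
  | add u u' _ _ h h' => rw [map_add]; exact add_mem h h'
  | mul u u' _ _ h h' => rw [map_mul]; simpa using mul_mem_homog h h'

/-- An element of weight at most `w` with vanishing leading form has weight at most `w - 1`. -/
theorem mem_fil_sub_one [CharZero k] (hn : 1 ≤ n) (hm : 1 ≤ m) (hd : d ≠ 0) {w : ℤ}
    {u : B n e m d r Q} (hu : u ∈ fil n e m d r Q w)
    (h0 : comp k wtX w (emb n e m d r Q u) = 0) : u ∈ fil n e m d r Q (w - 1) := by
  by_cases hex : ∃ j : ℕ, ∃ a b c : ℕ, -(a : ℤ) + n * b + (n * m + e) * c = w ∧ b + m * c = j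
  · classical
    -- all monomials of weight `w` are multiples of the one for which `b + m c` is least
    obtain ⟨a₀, b₀, c₀, hw, hj₀⟩ := Nat.find_spec hex
    have hmin (a b c : ℕ) (h : -(a : ℤ) + n * b + (n * m + e) * c = w) :
        b₀ + m * c₀ ≤ b + m * c := hj₀ ▸ Nat.find_min' hex ⟨a, b, c, h, rfl⟩
    obtain ⟨h, hh, hmem⟩ : ∃ h ∈ Algebra.adjoin k {s n e m d r Q, t n e m d r Q},
        u - monB n e m d r Q a₀ b₀ c₀ 0 0 * h ∈ fil n e m d r Q (w - 1) := by
      clear h0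
      induction hu using Submodule.span_induction with
      | mem u hu =>
        obtain ⟨a, b, c, p, q, hle, rfl⟩ := hu
        rcases hle.lt_or_eq with hlt | heq
        · exact ⟨0, zero_mem _, by simpa using monB_mem_fil (by omega)⟩
        · obtain ⟨j, hj⟩ := Nat.exists_eq_add_of_le (hmin a b c heq)
          refine ⟨brieskornB n e m d r Q ^ j * (s n e m d r Q ^ p * t n e m d r Q ^ q), ?_, ?_⟩
          · have hs : s n e m d r Q ∈ Algebra.adjoin k {s n e m d r Q, t n e m d r Q} :=
              Algebra.subset_adjoin (by simp)
            have ht : t n e m d r Q ∈ Algebra.adjoin k {s n e m d r Q, t n e m d r Q} :=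
              Algebra.subset_adjoin (by simp)
            exact mul_mem (pow_mem (add_mem (pow_mem hs _) (pow_mem ht _)) _)
              (mul_mem (pow_mem hs _) (pow_mem ht _))
          · have h1 := monB_sub_mem_fil (d := d) (r := r) (Q := Q) hn hm (heq.trans hw.symm) hj
            have h2 := mul_mem_fil h1 (monB_mem_fil (a := 0) (b := 0) (c := 0) (p := p) (q := q)
              le_rfl)
            rw [hw] at h2
            convert h2 using 1
            · simp
            · simp only [monB]; ring
      | zero => exact ⟨0, zero_mem _, by simp⟩
      | add u u' _ _ h h' =>
        obtain ⟨v, hv, h⟩ := h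
        obtain ⟨v', hv', h'⟩ := h'
        refine ⟨v + v', add_mem hv hv', ?_⟩
        convert add_mem h h' using 1
        ring
      | smul c u _ h =>
        obtain ⟨v, hv, h⟩ := h
        refine ⟨c • v, Subalgebra.smul_mem _ hv c, ?_⟩
        convert Submodule.smul_mem _ c h using 1
        rw [smul_sub, mul_smul_comm]
    have h1 := comp_eq_zero (emb_mem_degLE hn hm hmem)
    have h2 := emb_mem_homog_of_mem_adjoin hh
    obtain ⟨h3, h3'⟩ := emb_monB_mem (k := k) (Q := Q) (d := d) (r := r) (e := e) hn hm a₀ b₀ c₀ 0 0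
    have h4 := comp_mul h3 (homog_le_degLE _ _ h2)
    rw [h3', comp_eq_self h2, add_zero, hw] at h4
    rw [map_sub, map_sub, h0, zero_sub, neg_eq_zero, map_mul, h4, mul_eq_zero] at h1
    have h5 : h = 0 := by
      refine emb_injective n e m d r Q (by omega) hd (by omega) ?_
      rw [map_zero]
      refine h1.resolve_left ?_
      exact mul_ne_zero (mul_ne_zero (mon_ne_zero _ _ _) (pow_ne_zero _ (grY_ne_zero _ _ _)))
        (pow_ne_zero _ (grZ_ne_zero _ _ _ _ _))
    simpa [h5] using hmem
  · refine (Submodule.span_le.2 ?_ : fil n e m d r Q w ≤ fil n e m d r Q (w - 1)) hu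
    rintro _ ⟨a, b, c, p, q, hle, rfl⟩
    refine monB_mem_fil ?_
    have : -(a : ℤ) + n * b + (n * m + e) * c ≠ w := fun h => hex ⟨_, a, b, c, h, rfl⟩
    omega

/-- The filtration by weights is induced by the degree in `x⁻¹`. -/
theorem mem_fil_iff [CharZero k] (hn : 1 ≤ n) (hm : 1 ≤ m) (hd : d ≠ 0) {w : ℤ}
    {u : B n e m d r Q} : u ∈ fil n e m d r Q w ↔ emb n e m d r Q u ∈ degLE k wtX w := by
  refine ⟨emb_mem_degLE hn hm, fun h => ?_⟩
  obtain ⟨w', hw'⟩ := exists_mem_fil u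
  obtain ⟨N, hN⟩ : ∃ N : ℕ, w' ≤ w + N := ⟨(w' - w).toNat, by omega⟩
  replace hw' := fil_mono hN hw'
  clear hN
  induction N with
  | zero => simpa using hw'
  | succ N ih =>
    refine ih ?_
    have := mem_fil_sub_one hn hm hd hw' (comp_eq_zero (degLE_mono _ (by push_cast; omega) h))
    convert this using 1
    push_cast
    ring_nf

end Filtration

/-! ### The degree function `omegaB` -/

noncomputable section Degree

variable {k : Type*} [Field k] {n e m d r : ℕ} {Q : MvPolynomial (Fin 3) k}

/-- The degree of a Laurent polynomial in `x⁻¹`. -/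
def degX (a : Laurent k) : WithBot ℤ := a.coeff.support.sup fun g => (wtX g : WithBot ℤ)

theorem degX_le_iff {a : Laurent k} {i : ℤ} : degX a ≤ i ↔ a ∈ degLE k wtX i := by
  rw [degX, Finset.sup_le_iff, mem_degLE]
  refine forall_congr' fun g => ?_
  rw [Finsupp.mem_support_iff, WithBot.coe_le_coe, ← not_lt]
  tauto

theorem degX_eq {a : Laurent k} {i : ℤ} (h : a ∈ degLE k wtX i) (h0 : comp k wtX i a ≠ 0) :
    degX a = i := by
  refine le_antisymm (degX_le_iff.2 h) (not_lt.1 fun hlt => h0 (comp_eq_zero ?_))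
  rw [← degX_le_iff]
  induction hd : degX a using WithBot.recBotCoe with
  | bot => exact bot_le
  | coe j =>
    rw [hd, WithBot.coe_lt_coe] at hlt
    exact WithBot.coe_le_coe.2 (by omega)

theorem isDegreeFunction_degX : IsDegreeFunction (degX (k := k)) where
  eq_bot_iff a := by
    constructor
    · intro h
      by_contra ha
      obtain ⟨i, hi, h0⟩ := exists_comp_ne_zero wtX ha
      rw [degX_eq hi h0] at h
      exact WithBot.coe_ne_bot h
    · rintro rfl; rfl
  map_mul a b := by
    have h0 : degX (0 : Laurent k) = ⊥ := rfl
    by_cases ha : a = 0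
    · rw [ha, zero_mul, h0, WithBot.bot_add]
    by_cases hb : b = 0
    · rw [hb, mul_zero, h0, WithBot.add_bot]
    obtain ⟨i, hi, hi0⟩ := exists_comp_ne_zero wtX ha
    obtain ⟨j, hj, hj0⟩ := exists_comp_ne_zero wtX hb
    rw [degX_eq hi hi0, degX_eq hj hj0, degX_eq (mul_mem_degLE hi hj), WithBot.coe_add]
    rw [comp_mul hi hj]
    exact mul_ne_zero hi0 hj0
  map_add_le a b := by
    classical
    refine (Finset.sup_mono Finsupp.support_add).trans ?_
    rw [Finset.sup_union]
    rfl

theorem proj_monomial (α : Fin 5 →₀ ℕ) (c : k) : proj n e m d r Q (monomial α c) =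
    c • monB n e m d r Q (α 0) (α 1) (α 2) (α 3) (α 4) := by
  rw [proj, aeval_monomial, Finsupp.prod_fintype _ _ (by simp), Fin.prod_univ_five,
    ← Algebra.smul_def]
  rfl

theorem weight_weights (α : Fin 5 →₀ ℕ) : Finsupp.weight (weights n e m) α =
    -(α 0 : ℤ) + n * α 1 + (n * m + e) * α 2 := by
  rw [Finsupp.weight_apply, Finsupp.sum_fintype _ _ (by simp), Fin.sum_univ_five]
  simp [weights]
  ring

theorem mem_fil_iff_exists_proj {w : ℤ} {u : B n e m d r Q} : u ∈ fil n e m d r Q w ↔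
    ∃ P, proj n e m d r Q P = u ∧ weightedTotalDegree' (weights n e m) P ≤ w := by
  simp only [weightedTotalDegree', Finset.sup_le_iff, WithBot.coe_le_coe]
  constructor
  · intro hu
    induction hu using Submodule.span_induction with
    | mem u hu =>
      obtain ⟨a, b, c, p, q, h, rfl⟩ := hu
      refine ⟨monomial (Finsupp.equivFunOnFinite.symm ![a, b, c, p, q]) 1, ?_, ?_⟩
      · rw [proj_monomial, one_smul]; rfl
      · intro α hα
        obtain rfl := Finset.mem_singleton.1 (support_monomial_subset hα)
        rw [weight_weights]
        exact h
    | zero => exact ⟨0, map_zero _, by simp⟩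
    | add u u' _ _ h h' =>
      classical
      obtain ⟨P, rfl, hP⟩ := h
      obtain ⟨P', rfl, hP'⟩ := h'
      refine ⟨P + P', map_add _ _ _, fun α hα => ?_⟩
      rcases Finset.mem_union.1 (support_add hα) with h | h
      · exact hP α h
      · exact hP' α h
    | smul c u _ h =>
      obtain ⟨P, rfl, hP⟩ := h
      exact ⟨c • P, map_smul _ _ _, fun α hα => hP α (support_smul hα)⟩
  · rintro ⟨P, rfl, hP⟩
    rw [P.as_sum, map_sum]
    refine Submodule.sum_mem _ fun α hα => ?_
    rw [proj_monomial]
    refine Submodule.smul_mem _ _ (monB_mem_fil ?_)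
    rw [← weight_weights]
    exact hP α hα

variable [CharZero k]

theorem isLeast_liftDegrees (hn : 1 ≤ n) (hm : 1 ≤ m) (hd : d ≠ 0) (u : B n e m d r Q) :
    IsLeast (liftDegrees n e m d r Q u) (degX (emb n e m d r Q u)) := by
  have hlow : ∀ w ∈ liftDegrees n e m d r Q u, degX (emb n e m d r Q u) ≤ w := by
    rintro _ ⟨P, hP, rfl⟩
    induction hw : weightedTotalDegree' (weights n e m) P using WithBot.recBotCoe with
    | bot =>
      rw [(weightedTotalDegree'_eq_bot_iff _ _).1 hw, map_zero] at hP
      rw [← hP, map_zero]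
      exact bot_le
    | coe w => exact degX_le_iff.2 (emb_mem_degLE hn hm (mem_fil_iff_exists_proj.2 ⟨P, hP, hw.le⟩))
  refine ⟨?_, hlow⟩
  by_cases hu : u = 0
  · refine ⟨0, by rw [hu, map_zero], ?_⟩
    rw [hu, map_zero, weightedTotalDegree'_zero]
    rfl
  · have hu' : emb n e m d r Q u ≠ 0 := by
      rw [← map_zero (emb n e m d r Q)]
      exact (emb_injective n e m d r Q (by omega) hd (by omega)).ne hu
    obtain ⟨w, hw, hw0⟩ := exists_comp_ne_zero wtX hu'
    obtain ⟨P, hP, hle⟩ := mem_fil_iff_exists_proj.1 ((mem_fil_iff hn hm hd).2 hw)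
    refine ⟨P, hP, le_antisymm ?_ (hlow _ ⟨P, hP, rfl⟩)⟩
    rwa [degX_eq hw hw0]

theorem omegaB_eq (hn : 1 ≤ n) (hm : 1 ≤ m) (hd : d ≠ 0) (u : B n e m d r Q) :
    omegaB n e m d r Q u = degX (emb n e m d r Q u) :=
  (isLeast_liftDegrees hn hm hd u).csInf_eq

theorem isDegreeFunction_omegaB (hn : 1 ≤ n) (hm : 1 ≤ m) (hd : d ≠ 0) :
    IsDegreeFunction (omegaB n e m d r Q) where
  eq_bot_iff u := by
    rw [omegaB_eq hn hm hd, isDegreeFunction_degX.eq_bot_iff]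
    exact map_eq_zero_iff _ (emb_injective n e m d r Q (by omega) hd (by omega))
  map_mul u v := by
    simp only [omegaB_eq hn hm hd, map_mul, isDegreeFunction_degX.map_mul]
  map_add_le u v := by
    simp only [omegaB_eq hn hm hd, map_add]
    exact isDegreeFunction_degX.map_add_le _ _

theorem mem_filtration_iff (hn : 1 ≤ n) (hm : 1 ≤ m) (hd : d ≠ 0) {i : ℤ} {u : B n e m d r Q} :
    u ∈ filtration (omegaB n e m d r Q) i ↔ emb n e m d r Q u ∈ degLE k wtX i := by
  rw [← degX_le_iff, ← omegaB_eq hn hm hd]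
  rfl

end Degree

/-! ### Derivations of `B` -/

noncomputable section Derivations

variable {k : Type*} [Field k] {n e m d r : ℕ} {Q : MvPolynomial (Fin 3) k}

/-- The additive map with the values `α, β, γ` at the exponents of `x, s, t`. -/
def logHom (α β γ : Laurent k) : ℤ × ℤ × ℤ →+ Laurent k :=
  (zmultiplesHom _ α).coprod ((zmultiplesHom _ β).coprod (zmultiplesHom _ γ))

theorem logDer_logHom_mon (α β γ : Laurent k) (i p q : ℤ) :
    logDer (logHom α β γ) (mon k i p q) = mon k i p q * (i • α + (p • β + q • γ)) := by
  rw [mon, logDer_single]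
  simp [logHom]

variable (D : Derivation k (B n e m d r Q) (B n e m d r Q))

/-- The logarithmic derivatives of `x, s, t` with respect to the extension of `D` to the Laurent
polynomials. -/
def extHom : ℤ × ℤ × ℤ →+ Laurent k :=
  logHom (mon k (-1) 0 0 * emb n e m d r Q (D (x n e m d r Q)))
    (mon k 0 (-1) 0 * emb n e m d r Q (D (s n e m d r Q)))
    (mon k 0 0 (-1) * emb n e m d r Q (D (t n e m d r Q)))

/-- Every derivation of `B` extends to the Laurent polynomials. -/
theorem logDer_extHom_emb (u : B n e m d r Q) :
    logDer (extHom D) (emb n e m d r Q u) = emb n e m d r Q (D u) := by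
  let S : Subalgebra k (B n e m d r Q) :=
    { carrier := {u | logDer (extHom D) (emb n e m d r Q u) = emb n e m d r Q (D u)}
      mul_mem' := by
        intro u v hu hv
        simp only [Set.mem_ofPred_eq] at hu hv ⊢
        simp only [map_mul, Derivation.leibniz, hu, hv, smul_eq_mul, map_add]
      add_mem' := by
        intro u v hu hv
        simp only [Set.mem_ofPred_eq] at hu hv ⊢
        simp only [map_add, hu, hv]
      algebraMap_mem' := by
        intro c
        simp only [Set.mem_ofPred_eq, AlgHom.commutes, Derivation.map_algebraMap, map_zero] }
  have hx : x n e m d r Q ∈ S := by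
    change logDer (extHom D) (emb n e m d r Q _) = emb n e m d r Q (D _)
    rw [emb_x, extHom, logDer_logHom_mon]
    simp [← mul_assoc, mon_mul_mon, mon_zero]
  have hs : s n e m d r Q ∈ S := by
    change logDer (extHom D) (emb n e m d r Q _) = emb n e m d r Q (D _)
    rw [emb_s, extHom, logDer_logHom_mon]
    simp [← mul_assoc, mon_mul_mon, mon_zero]
  have ht : t n e m d r Q ∈ S := by
    change logDer (extHom D) (emb n e m d r Q _) = emb n e m d r Q (D _)
    rw [emb_t, extHom, logDer_logHom_mon]
    simp [← mul_assoc, mon_mul_mon, mon_zero]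
  have hP (P : MvPolynomial (Fin 3) k) : polyXST n e m d r Q P ∈ S := by
    induction P using MvPolynomial.induction_on with
    | C c => rw [← algebraMap_eq, AlgHom.commutes]; exact S.algebraMap_mem c
    | add P P' h h' => rw [map_add]; exact add_mem h h'
    | mul_X P i h =>
      rw [map_mul]
      refine mul_mem h ?_
      fin_cases i <;> simpa [polyXST]
  obtain ⟨N, P, hN⟩ := exists_x_pow_mul_eq n e m d r Q u
  have h1 : x n e m d r Q ^ N ∈ S := pow_mem hx N
  have h2 : x n e m d r Q ^ N * u ∈ S := hN ▸ hP P
  change logDer (extHom D) (emb n e m d r Q _) = emb n e m d r Q (D _) at h1 h2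
  simp only [map_mul, Derivation.leibniz, h1, smul_eq_mul, map_add] at h2
  refine mul_left_cancel₀ (a := emb n e m d r Q (x n e m d r Q ^ N)) ?_ (add_right_cancel h2)
  rw [map_pow, emb_x]
  exact pow_ne_zero _ (mon_ne_zero _ _ _)

theorem iterate_logDer_extHom_emb (N : ℕ) (u : B n e m d r Q) :
    (logDer (extHom D))^[N] (emb n e m d r Q u) = emb n e m d r Q ((D : _ → _)^[N] u) := by
  induction N with
  | zero => rfl
  | succ N ih =>
    rw [Function.iterate_succ_apply', ih, logDer_extHom_emb, Function.iterate_succ_apply']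

variable {D}

theorem extHom_ne_zero (hn : 1 ≤ n) (hm : 1 ≤ m) (hd : d ≠ 0) (hD : D ≠ 0) : extHom D ≠ 0 := by
  intro h0
  refine hD (Derivation.ext fun u => ?_)
  refine emb_injective n e m d r Q (by omega) hd (by omega) ?_
  rw [← logDer_extHom_emb, h0, Derivation.zero_apply, map_zero]
  refine AddMonoidAlgebra.induction_linear (emb n e m d r Q u) (map_zero _) ?_ ?_
  · intro a b ha hb
    rw [map_add, ha, hb, add_zero]
  · intro g c
    rw [logDer_single, AddMonoidHom.zero_apply, mul_zero]

/-- The leading part of `D` with respect to the degree in `x⁻¹` acts on leading forms: an iterate of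
`D`, applied to `u` of degree at most `w`, has the component of degree `w + N τ` that the iterate of
the leading part gives for the leading form of `u`. -/
theorem iterate_leading_apply (hn : 1 ≤ n) (hm : 1 ≤ m) {τ w : ℤ}
    (hτ : ∀ g, extHom D g ∈ degLE k wtX τ) {u : B n e m d r Q} (hu : u ∈ fil n e m d r Q w)
    (N : ℕ) : (logDer (compHom k wtX τ (extHom D)))^[N] (comp k wtX w (emb n e m d r Q u)) =
      comp k wtX (w + N * τ) (emb n e m d r Q ((D : _ → _)^[N] u)) := by
  rw [← iterate_logDer_extHom_emb, comp_iterate_logDer hτ (emb_mem_degLE hn hm hu)]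

theorem grAlg_le_nilSubalgebra (hn : 1 ≤ n) (hm : 1 ≤ m) (hD : IsLocallyNilpotent D) {τ : ℤ}
    (hτ : ∀ g, extHom D g ∈ degLE k wtX τ) :
    grAlg k n e m d r ≤ nilSubalgebra (logDer (compHom k wtX τ (extHom D))) := by
  have h (a b c p q : ℕ) : grMon k n e m d r a b c p q ∈
      nilSubalgebra (logDer (compHom k wtX τ (extHom D))) := by
    obtain ⟨u, hu, h⟩ := exists_comp_emb_eq (Q := Q) hn hm
      (grMon_mem_grPiece (k := k) (d := d) (r := r) (p := p) (q := q) (a := a) (b := b) (c := c)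
        rfl)
    obtain ⟨N, hN⟩ := hD u
    refine ⟨N, ?_⟩
    rw [← h, iterate_leading_apply hn hm hτ hu, hN, map_zero, map_zero]
  refine Algebra.adjoin_le ?_
  rintro _ (rfl | rfl | rfl | rfl | rfl)
  · simpa [grMon] using h 1 0 0 0 0
  · simpa [grMon, mon_zero] using h 0 1 0 0 0
  · simpa [grMon, mon_zero] using h 0 0 1 0 0
  · simpa [grMon] using h 0 0 0 1 0
  · simpa [grMon] using h 0 0 0 0 1

variable [CharZero k]

theorem leading_mem_grPiece (hn : 1 ≤ n) (hm : 1 ≤ m) (hd : d ≠ 0) {τ w : ℤ}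
    (hτ : ∀ g, extHom D g ∈ degLE k wtX τ) {a : Laurent k} (ha : a ∈ grPiece k n e m d r w) :
    logDer (compHom k wtX τ (extHom D)) a ∈ grPiece k n e m d r (w + τ) := by
  obtain ⟨u, hu, rfl⟩ := exists_comp_emb_eq (Q := Q) hn hm ha
  have h := iterate_leading_apply hn hm hτ hu 1
  simp only [Function.iterate_one, Nat.cast_one, one_mul] at h
  rw [h]
  refine comp_emb_mem_grPiece hn hm ((mem_fil_iff hn hm hd).2 ?_)
  rw [← logDer_extHom_emb]
  exact logDer_mem_degLE hτ (emb_mem_degLE hn hm hu)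

/-- The leading part of a nonzero locally nilpotent derivation of `B` does not kill the leading form
of `z`. -/
theorem leading_grZ_ne_zero (hn : 1 ≤ n) (hne : (n, e) ≠ (1, 0)) (hm : 1 ≤ m) (hd : 2 ≤ d)
    (hr : 2 ≤ r) (hdr : Nat.gcd d r = 1) (hD : IsLocallyNilpotent D) {τ : ℤ}
    (hτ : ∀ g, extHom D g ∈ degLE k wtX τ) (h0 : compHom k wtX τ (extHom D) ≠ 0) :
    logDer (compHom k wtX τ (extHom D)) (grZ k n e m d r) ≠ 0 := fun hz =>
  h0 (eq_zero_of_homogeneous hn hne hm hd hr hdr (grAlg_le_nilSubalgebra hn hm hD hτ)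
    (fun _ _ => leading_mem_grPiece hn hm (by omega) hτ) hz)

/-- The constants of a nonzero locally nilpotent derivation of `B` have degree at most `0`: the
leading form of a constant of positive degree is a constant of the leading part, and `z` divides a
power of it, so `z` would be killed too. -/
theorem mem_fil_zero_of_map_eq_zero (hn : 1 ≤ n) (hne : (n, e) ≠ (1, 0)) (hm : 1 ≤ m) (hd : 2 ≤ d)
    (hr : 2 ≤ r) (hdr : Nat.gcd d r = 1) (hD : IsLocallyNilpotent D) (hD0 : D ≠ 0)
    {u : B n e m d r Q} (hu : D u = 0) : u ∈ fil n e m d r Q 0 := by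
  obtain ⟨τ, hτ, h0⟩ := exists_compHom_ne_zero wtX (extHom_ne_zero hn hm (by omega) hD0)
  by_cases hu0 : emb n e m d r Q u = 0
  · rw [mem_fil_iff hn hm (by omega), hu0]
    exact zero_mem _
  obtain ⟨w, hw, hw0⟩ := exists_comp_ne_zero wtX hu0
  rw [← mem_fil_iff hn hm (by omega)] at hw
  rcases le_or_gt w 0 with hw' | hw'
  · exact fil_mono hw' hw
  exfalso
  have hnil := grAlg_le_nilSubalgebra (e := e) hn hm hD hτ
  obtain ⟨v, hv, h⟩ := exists_pow_eq_grZ_mul hw' (comp_emb_mem_grPiece hn hm hw)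
  refine leading_grZ_ne_zero hn hne hm hd hr hdr hD hτ h0 ?_
  refine map_eq_zero_of_mul (hnil grZ_mem_grAlg) (hnil hv) (h ▸ pow_ne_zero _ hw0) ?_
  have h1 := iterate_leading_apply hn hm hτ hw 1
  simp only [Function.iterate_one, hu, map_zero] at h1
  rw [← h, Derivation.leibniz_pow, h1]
  simp

/-- The degree of a derivation of `B` is the degree of its leading part: if it were smaller, the
leading part would kill `x`, `s` and `t`. -/
theorem hasDegree_of_leading (hn : 1 ≤ n) (hm : 1 ≤ m) (hd : d ≠ 0) {τ : ℤ}
    (hτ : ∀ g, extHom D g ∈ degLE k wtX τ) (h0 : compHom k wtX τ (extHom D) ≠ 0) :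
    HasDegree (omegaB n e m d r Q) D τ := by
  constructor
  · intro i u hu
    rw [mem_filtration_iff hn hm hd] at hu ⊢
    rw [← logDer_extHom_emb]
    exact logDer_mem_degLE hτ hu
  · intro σ hσ
    by_contra! hlt
    have key (i p q : ℤ) (u : B n e m d r Q) (hu : emb n e m d r Q u = mon k i p q) :
        logDer (compHom k wtX τ (extHom D)) (mon k i p q) = 0 := by
      have hmem : mon k i p q ∈ homog k wtX (-i) := mon_mem_homog_wtX rfl
      have h1 : emb n e m d r Q (D u) ∈ degLE k wtX (-i + σ) := by
        rw [← mem_filtration_iff hn hm hd]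
        refine hσ (-i) u ?_
        rw [mem_filtration_iff hn hm hd, hu]
        exact homog_le_degLE _ _ hmem
      have h2 := comp_logDer hτ (homog_le_degLE _ _ hmem)
      rw [comp_eq_self hmem, ← hu, logDer_extHom_emb, hu] at h2
      rw [← h2]
      exact comp_eq_zero (degLE_mono _ (by omega) h1)
    exact h0 (eq_zero_of_logDer_eq_zero (key _ _ _ _ (emb_x n e m d r Q))
      (key _ _ _ _ (emb_s n e m d r Q)) (key _ _ _ _ (emb_t n e m d r Q)))

/-- If the degree were larger than `- n - e`, the leading part of the derivation would map `z` to a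
multiple of `z`, hence to `0`. -/
theorem exists_hasDegree_le (hn : 1 ≤ n) (hne : (n, e) ≠ (1, 0)) (hm : 1 ≤ m) (hd : 2 ≤ d)
    (hr : 2 ≤ r) (hdr : Nat.gcd d r = 1) (hD : IsLocallyNilpotent D) (hD0 : D ≠ 0) :
    ∃ τ : ℤ, HasDegree (omegaB n e m d r Q) D τ ∧ τ ≤ -(n : ℤ) - (e : ℤ) := by
  obtain ⟨τ, hτ, h0⟩ := exists_compHom_ne_zero wtX (extHom_ne_zero hn hm (by omega) hD0)
  refine ⟨τ, hasDegree_of_leading hn hm (by omega) hτ h0, ?_⟩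
  by_contra! hlt
  have hnil := grAlg_le_nilSubalgebra (e := e) hn hm hD hτ
  have h1 : grZ k n e m d r ∈ grPiece k n e m d r (n * m + e) := by
    rw [grZ_eq_grMon]
    exact grMon_mem_grPiece (by simp)
  obtain ⟨v, hv, h⟩ := exists_eq_grZ_mul (by linarith)
    (leading_mem_grPiece (Q := Q) hn hm (by omega) hτ h1)
  exact leading_grZ_ne_zero hn hne hm hd hr hdr hD hτ h0
    (map_eq_zero_of_dvd (hnil grZ_mem_grAlg) (hnil hv) h)

end Derivations

/-! ### The Derksen invariant -/

noncomputable section Derksen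

variable {k : Type*} [Field k]

section UpperBound

variable (n e m d r : ℕ) (Q : MvPolynomial (Fin 3) k)

/-- The subalgebra of `B` generated by `x, s, t`. -/
abbrev algXST : Subalgebra k (B n e m d r Q) :=
  Algebra.adjoin k {x n e m d r Q, s n e m d r Q, t n e m d r Q}

theorem polyXST_mem_algXST (P : MvPolynomial (Fin 3) k) :
    polyXST n e m d r Q P ∈ algXST n e m d r Q := by
  induction P using MvPolynomial.induction_on with
  | C c => rw [← algebraMap_eq, AlgHom.commutes]; exact Subalgebra.algebraMap_mem _ c
  | add P P' h h' => rw [map_add]; exact add_mem h h'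
  | mul_X P i h =>
    rw [map_mul]
    refine mul_mem h (Algebra.subset_adjoin ?_)
    fin_cases i <;> simp [polyXST]

theorem fil_zero_le_algXST :
    fil n e m d r Q 0 ≤ Subalgebra.toSubmodule (algXST n e m d r Q) := by
  have hx : x n e m d r Q ∈ algXST n e m d r Q := Algebra.subset_adjoin (by simp)
  have hs : s n e m d r Q ∈ algXST n e m d r Q := Algebra.subset_adjoin (by simp)
  have ht : t n e m d r Q ∈ algXST n e m d r Q := Algebra.subset_adjoin (by simp)
  have hy : x n e m d r Q ^ n * y n e m d r Q ∈ algXST n e m d r Q := by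
    rw [relation_y]
    exact add_mem (add_mem (pow_mem hs d) (pow_mem ht r))
      (mul_mem hx (polyXST_mem_algXST n e m d r Q Q))
  have hz : x n e m d r Q ^ (n * m + e) * z n e m d r Q ∈ algXST n e m d r Q := by
    have h : x n e m d r Q ^ (n * m + e) * z n e m d r Q =
        (x n e m d r Q ^ n * y n e m d r Q) ^ m - x n e m d r Q ^ (n * m) * s n e m d r Q := by
      rw [pow_add, mul_assoc, relation_z]; ring
    rw [h]
    exact sub_mem (pow_mem hy m) (mul_mem (pow_mem hx _) hs)
  refine Submodule.span_le.2 ?_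
  rintro _ ⟨a, b, c, p, q, h, rfl⟩
  obtain ⟨l, rfl⟩ : ∃ l, a = n * b + (n * m + e) * c + l :=
    Nat.exists_eq_add_of_le (by zify; linarith)
  have h : monB n e m d r Q (n * b + (n * m + e) * c + l) b c p q =
      (x n e m d r Q ^ n * y n e m d r Q) ^ b * (x n e m d r Q ^ (n * m + e) * z n e m d r Q) ^ c *
        x n e m d r Q ^ l * s n e m d r Q ^ p * t n e m d r Q ^ q := by
    rw [monB]; ring
  rw [h]
  change _ ∈ algXST n e m d r Q
  exact mul_mem (mul_mem (mul_mem (mul_mem (pow_mem hy _) (pow_mem hz _)) (pow_mem hx _))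
    (pow_mem hs _)) (pow_mem ht _)

theorem emb_mem_degLE_of_mem_algXST {u : B n e m d r Q} (hu : u ∈ algXST n e m d r Q) :
    emb n e m d r Q u ∈ degLE k wtX 0 := by
  have h : algXST n e m d r Q ≤ (polyXST n e m d r Q).range := by
    refine Algebra.adjoin_le ?_
    rintro _ (rfl | rfl | rfl)
    · exact ⟨X 0, by simp [polyXST]⟩
    · exact ⟨X 1, by simp [polyXST]⟩
    · exact ⟨X 2, by simp [polyXST]⟩
  obtain ⟨P, rfl⟩ := h hu
  change emb n e m d r Q (polyXST n e m d r Q P) ∈ _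
  rw [emb_polyXST]
  exact evalXST_mem_degLE P

/-- A derivation of the Laurent polynomials that maps the image of `B` to itself restricts to
`B`. -/
theorem exists_derivation (hm : m ≠ 0) (hd : d ≠ 0) (hn : n ≠ 0)
    (E : Derivation k (Laurent k) (Laurent k)) (hx : E (mon k 1 0 0) ∈ (emb n e m d r Q).range)
    (hy : E (embY n d r Q) ∈ (emb n e m d r Q).range)
    (hz : E (embZ n e m d r Q) ∈ (emb n e m d r Q).range)
    (ht : E (mon k 0 0 1) ∈ (emb n e m d r Q).range) :
    ∃ D : Derivation k (B n e m d r Q) (B n e m d r Q),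
      ∀ u, emb n e m d r Q (D u) = E (emb n e m d r Q u) := by
  have hall (u : B n e m d r Q) : ∃ v, emb n e m d r Q v = E (emb n e m d r Q u) := by
    have hu : u ∈ Algebra.adjoin k ({x n e m d r Q, y n e m d r Q, z n e m d r Q,
      t n e m d r Q} : Set (B n e m d r Q)) := by
      rw [adjoin_eq_top]; trivial
    induction hu using Algebra.adjoin_induction with
    | mem u hu =>
      rcases hu with rfl | rfl | rfl | rfl
      · rw [emb_x]; exact hx
      · rw [emb_y]; exact hy
      · rw [emb_z]; exact hz
      · rw [emb_t]; exact ht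
    | algebraMap c =>
      exact ⟨0, by rw [AlgHom.commutes, Derivation.map_algebraMap, map_zero]⟩
    | add u u' _ _ h h' =>
      obtain ⟨v, h⟩ := h
      obtain ⟨v', h'⟩ := h'
      exact ⟨v + v', by simp only [map_add, h, h']⟩
    | mul u u' _ _ h h' =>
      obtain ⟨v, h⟩ := h
      obtain ⟨v', h'⟩ := h'
      exact ⟨u * v' + u' * v, by simp only [map_add, map_mul, Derivation.leibniz, smul_eq_mul,
        h, h']⟩
  have hinj := emb_injective n e m d r Q hm hd hn
  choose f hf using hall
  let L : B n e m d r Q →ₗ[k] B n e m d r Q :=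
    { toFun := f
      map_add' := fun u v => hinj (by simp only [map_add, hf])
      map_smul' := fun c u => hinj (by
        rw [map_smul, hf, map_smul, E.map_smul, RingHom.id_apply, hf]) }
  refine ⟨Derivation.mk' L fun u v => hinj ?_, hf⟩
  change emb n e m d r Q (f (u * v)) = emb n e m d r Q (u * f v + v * f u)
  simp only [map_add, map_mul, Derivation.leibniz, smul_eq_mul, hf]

/-- Some locally nilpotent derivation of `B` kills `x` and has the values `α x ^ (n + e)` and
`β x ^ (n + e)` at `s` and `t`. The factor `x ^ (n + e)` makes its values at `y` and `z` lie in
`B`. -/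
theorem exists_isLocallyNilpotent (hm : m ≠ 0) (hd : d ≠ 0) (hn : n ≠ 0) (α β : k) :
    ∃ D : Derivation k (B n e m d r Q) (B n e m d r Q), IsLocallyNilpotent D ∧
      D (x n e m d r Q) = 0 ∧ D (s n e m d r Q) = α • x n e m d r Q ^ (n + e) ∧
      D (t n e m d r Q) = β • x n e m d r Q ^ (n + e) := by
  set E := logDer (logHom 0 (α • mon k (n + e : ℕ) (-1) 0) (β • mon k (n + e : ℕ) 0 (-1)))
    with hE
  have hEx (i : ℤ) : E (mon k i 0 0) = 0 := by
    rw [hE, logDer_logHom_mon]; simp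
  have hEs : E (mon k 0 1 0) = α • mon k (n + e : ℕ) 0 0 := by
    rw [hE, logDer_logHom_mon]; simp [mon_mul_mon]
  have hEt : E (mon k 0 0 1) = β • mon k (n + e : ℕ) 0 0 := by
    rw [hE, logDer_logHom_mon]; simp [mon_mul_mon]
  have hEP (P : MvPolynomial (Fin 3) k) :
      ∃ P', E (evalXST P) = mon k (n + e : ℕ) 0 0 * evalXST P' := by
    induction P using MvPolynomial.induction_on with
    | C c => exact ⟨0, by
        rw [← algebraMap_eq, AlgHom.commutes, Derivation.map_algebraMap, map_zero, mul_zero]⟩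
    | add P P' h h' =>
      obtain ⟨R, h⟩ := h
      obtain ⟨R', h'⟩ := h'
      exact ⟨R + R', by simp only [map_add, h, h']; ring⟩
    | mul_X P i h =>
      obtain ⟨R, h⟩ := h
      obtain ⟨c, hc⟩ : ∃ c : k, E (evalXST (X i)) = evalXST (C c) * mon k (n + e : ℕ) 0 0 := by
        have hC (c : k) : evalXST (C c) * mon k (n + e : ℕ) 0 0 = c • mon k (n + e : ℕ) 0 0 := by
          rw [← algebraMap_eq, AlgHom.commutes, ← Algebra.smul_def]
        simp only [hC]
        fin_cases i
        · exact ⟨0, by simp [evalXST, hEx]⟩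
        · exact ⟨α, by simpa [evalXST] using hEs⟩
        · exact ⟨β, by simpa [evalXST] using hEt⟩
      refine ⟨X i * R + C c * P, ?_⟩
      rw [map_mul, Derivation.leibniz, hc, h, map_add, map_mul, map_mul, smul_eq_mul, smul_eq_mul]
      ring
  have hmem (i : ℕ) : mon k i 0 0 ∈ (emb n e m d r Q).range :=
    ⟨x n e m d r Q ^ i, by
      change emb n e m d r Q _ = _
      rw [map_pow, emb_x, mon_pow]; simp⟩
  have hmemP (P : MvPolynomial (Fin 3) k) : evalXST P ∈ (emb n e m d r Q).range :=
    ⟨_, emb_polyXST n e m d r Q P⟩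
  have hF : embF d r Q = evalXST (X 1 ^ d + X 2 ^ r + X 0 * Q) := by
    simp [embF, brieskorn, evalXST, mon_pow]
  obtain ⟨R, hR⟩ := hEP (X 1 ^ d + X 2 ^ r + X 0 * Q)
  have hEY : E (embY n d r Q) = mon k e 0 0 * evalXST R := by
    rw [embY, Derivation.leibniz, hEx, hF, hR, smul_zero, add_zero, smul_eq_mul, ← mul_assoc,
      mon_mul_mon]
    simp
  have hEZ : E (embZ n e m d r Q) = m * embY n d r Q ^ (m - 1) * evalXST R - α • mon k n 0 0 := by
    rw [embZ, Derivation.leibniz, hEx, map_sub, Derivation.leibniz_pow, hEY, hEs, smul_zero,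
      add_zero]
    simp only [smul_eq_mul, mul_sub, nsmul_eq_mul, mul_smul_comm, mon_mul_mon]
    congr 1
    · have h1 : mon k (-e) 0 0 * mon k e 0 0 = 1 := by rw [mon_mul_mon]; simp [mon_zero]
      linear_combination (m * embY n d r Q ^ (m - 1) * evalXST R) * h1
    · simp
  have hY : embY n d r Q ∈ (emb n e m d r Q).range := ⟨_, emb_y n e m d r Q⟩
  obtain ⟨D, hD⟩ := exists_derivation n e m d r Q hm hd hn E (by rw [hEx]; exact zero_mem _)
    (by rw [hEY]; exact mul_mem (hmem e) (hmemP R))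
    (by
      rw [hEZ]
      exact sub_mem (mul_mem (mul_mem (natCast_mem _ m) (pow_mem hY _)) (hmemP R))
        (Subalgebra.smul_mem _ (hmem n) α))
    (by rw [hEt]; exact Subalgebra.smul_mem _ (hmem _) β)
  have hinj := emb_injective n e m d r Q hm hd hn
  refine ⟨D, ?_, hinj ?_, hinj ?_, hinj ?_⟩
  · intro u
    have hx (i : ℤ) : mon k i 0 0 ∈ nilSubalgebra E := mem_nilSubalgebra_of_map_eq_zero (hEx i)
    have hs : mon k 0 1 0 ∈ nilSubalgebra E :=
      mem_nilSubalgebra_of_map_mem (by rw [hEs]; exact Subalgebra.smul_mem _ (hx _) α)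
    have ht : mon k 0 0 1 ∈ nilSubalgebra E :=
      mem_nilSubalgebra_of_map_mem (by rw [hEt]; exact Subalgebra.smul_mem _ (hx _) β)
    have hP (P : MvPolynomial (Fin 3) k) : evalXST P ∈ nilSubalgebra E := by
      induction P using MvPolynomial.induction_on with
      | C c => rw [← algebraMap_eq, AlgHom.commutes]; exact Subalgebra.algebraMap_mem _ c
      | add P P' h h' => rw [map_add]; exact add_mem h h'
      | mul_X P i h =>
        rw [map_mul]
        refine mul_mem h ?_
        fin_cases i <;> simp [evalXST, hx, hs, ht]
    have hu : emb n e m d r Q u ∈ nilSubalgebra E := by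
      obtain ⟨N, P, h⟩ := exists_x_pow_mul_eq n e m d r Q u
      have h1 : emb n e m d r Q u = mon k (-N) 0 0 * evalXST P := by
        rw [← emb_polyXST n e m d r Q, ← h, map_mul, map_pow, emb_x, mon_pow, ← mul_assoc,
          mon_mul_mon]
        simp [mon_zero]
      rw [h1]
      exact mul_mem (hx _) (hP P)
    obtain ⟨N, hN⟩ := hu
    refine ⟨N, hinj ?_⟩
    rw [map_zero, ← hN]
    exact Function.Semiconj.iterate_right (f := emb n e m d r Q) hD N u
  · rw [hD, emb_x, hEx, map_zero]
  · rw [hD, emb_s, hEs, map_smul, map_pow, emb_x, mon_pow]; simp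
  · rw [hD, emb_t, hEt, map_smul, map_pow, emb_x, mon_pow]; simp

theorem algXST_le_derksenInvariant (hm : m ≠ 0) (hd : d ≠ 0) (hn : n ≠ 0) :
    algXST n e m d r Q ≤ derksenInvariant k (B n e m d r Q) := by
  have := isDomain_B n e m d r Q hm hd hn
  have hx0 : x n e m d r Q ^ (n + e) ≠ 0 := by
    refine pow_ne_zero _ fun h => mon_ne_zero (k := k) 1 0 0 ?_
    rw [← emb_x n e m d r Q, h, map_zero]
  obtain ⟨D, hD, hDx, hDs, hDt⟩ := exists_isLocallyNilpotent n e m d r Q hm hd hn 1 0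
  obtain ⟨D', hD', hDx', hDs', hDt'⟩ := exists_isLocallyNilpotent n e m d r Q hm hd hn 0 1
  rw [one_smul] at hDs hDt'
  rw [zero_smul] at hDt hDs'
  have h0 : D ≠ 0 := by rintro rfl; exact hx0 hDs.symm
  have h0' : D' ≠ 0 := by rintro rfl; exact hx0 hDt'.symm
  refine Algebra.adjoin_le ?_
  rintro _ (rfl | rfl | rfl)
  · exact Algebra.subset_adjoin ⟨D, hD, h0, hDx⟩
  · exact Algebra.subset_adjoin ⟨D', hD', h0', hDs'⟩
  · exact Algebra.subset_adjoin ⟨D, hD, h0, hDt⟩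

theorem derksenInvariant_B [CharZero k] (hn : 1 ≤ n) (hne : (n, e) ≠ (1, 0)) (hm : 1 ≤ m)
    (hd : 2 ≤ d) (hr : 2 ≤ r) (hdr : Nat.gcd d r = 1) :
    derksenInvariant k (B n e m d r Q) = algXST n e m d r Q := by
  refine le_antisymm (Algebra.adjoin_le ?_)
    (algXST_le_derksenInvariant n e m d r Q (by omega) (by omega) (by omega))
  rintro u ⟨D, hD, hD0, hu⟩
  exact fil_zero_le_algXST n e m d r Q (mem_fil_zero_of_map_eq_zero hn hne hm hd hr hdr hD hD0 hu)

/-- `k[x, s, t]` is not all of `B`: its elements have degree at most `0`, but `y` has degree `n`. -/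
theorem y_notMem_algXST [CharZero k] (hn : 1 ≤ n) : y n e m d r Q ∉ algXST n e m d r Q := by
  intro h
  have h1 := emb_mem_degLE_of_mem_algXST n e m d r Q h
  rw [emb_y] at h1
  have h2 := comp_eq_zero (degLE_mono wtX (show (0 : ℤ) ≤ n - 1 by omega) h1)
  rw [(embY_mem n d r Q).2] at h2
  exact grY_ne_zero _ _ _ h2

end UpperBound

/-- The Derksen invariant of a polynomial ring in three variables is the whole ring: every variable
is killed by the partial derivative with respect to another one. -/
theorem derksenInvariant_eq_top {A : Type*} [CommRing A] [Algebra k A]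
    (φ : A ≃ₐ[k] MvPolynomial (Fin 3) k) : derksenInvariant k A = ⊤ := by
  have h (i j : Fin 3) (hij : i ≠ j) : φ.symm (X j) ∈ derksenInvariant k A := by
    let L : A →ₗ[k] A := φ.symm.toLinearMap ∘ₗ (pderiv i).toLinearMap ∘ₗ φ.toLinearMap
    have hL (a : A) : φ (L a) = pderiv i (φ a) := φ.apply_symm_apply _
    let D : Derivation k A A := Derivation.mk' L fun a b => φ.injective <| by
      simp only [hL, map_mul, Derivation.leibniz, smul_eq_mul, map_add]
    have hD (a : A) : φ (D a) = pderiv i (φ a) := hL a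
    refine Algebra.subset_adjoin ⟨D, fun a => ?_, fun h0 => ?_, ?_⟩
    · have hX (P : MvPolynomial (Fin 3) k) :
          P ∈ nilSubalgebra (pderiv i : Derivation k _ (MvPolynomial (Fin 3) k)) := by
        have hP : P ∈ Algebra.adjoin k (Set.range X) := by
          rw [adjoin_range_X]; trivial
        refine Algebra.adjoin_le ?_ hP
        rintro _ ⟨l, rfl⟩
        refine mem_nilSubalgebra_of_map_mem ?_
        rw [pderiv_X]
        refine mem_nilSubalgebra_of_map_eq_zero ?_
        by_cases hl : l = i <;> simp [hl]
      obtain ⟨N, hN⟩ := hX (φ a)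
      refine ⟨N, φ.injective ?_⟩
      rw [map_zero, ← hN]
      exact Function.Semiconj.iterate_right (f := φ) hD N a
    · have := hD (φ.symm (X i))
      rw [h0] at this
      simp at this
    · refine φ.injective ?_
      rw [hD, φ.apply_symm_apply, pderiv_X_of_ne hij.symm, map_zero]
  rw [eq_top_iff]
  rintro a -
  have ha : φ a ∈ (derksenInvariant k A).comap φ.symm.toAlgHom := by
    have hP : φ a ∈ Algebra.adjoin k (Set.range X) := by
      rw [adjoin_range_X]; trivial
    refine Algebra.adjoin_le ?_ hP
    rintro _ ⟨j, rfl⟩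
    exact h (j + 1) j (by simp)
  simpa using ha

end Derksen

end LND

theorem mainTheorem3 {k : Type*} [Field k] [CharZero k] (n e m d r : ℕ)
    (hn : 1 ≤ n) (hne : (n, e) ≠ (1, 0)) (hm : 2 ≤ m) (hd : 2 ≤ d) (hr : 2 ≤ r)
    (hdr : Nat.gcd d r = 1) (Q : MvPolynomial (Fin 3) k) :
    IsDomain (LND.B n e m d r Q) ∧
    LND.derksenInvariant k (LND.B n e m d r Q) =
      Algebra.adjoin k {LND.x n e m d r Q, LND.s n e m d r Q, LND.t n e m d r Q} ∧
    IsEmpty (LND.B n e m d r Q ≃ₐ[k] MvPolynomial (Fin 3) k) ∧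
    (∀ p : LND.B n e m d r Q,
      IsLeast (LND.liftDegrees n e m d r Q p) (LND.omegaB n e m d r Q p)) ∧
    LND.IsDegreeFunction (LND.omegaB n e m d r Q) ∧
    ∀ D : Derivation k (LND.B n e m d r Q) (LND.B n e m d r Q),
      LND.IsLocallyNilpotent D → D ≠ 0 →
        ∃ τ : ℤ, LND.HasDegree (LND.omegaB n e m d r Q) D τ ∧ τ ≤ -(n : ℤ) - (e : ℤ) := by
  have hm' : 1 ≤ m := by omega
  have hd' : d ≠ 0 := by omega
  have hD := LND.derksenInvariant_B n e m d r Q hn hne hm' hd hr hdr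
  refine ⟨LND.isDomain_B n e m d r Q (by omega) hd' (by omega), hD, ⟨fun φ => ?_⟩, fun p => ?_,
    LND.isDegreeFunction_omegaB hn hm' hd',
    fun D hD hD0 => LND.exists_hasDegree_le hn hne hm' hd hr hdr hD hD0⟩
  · refine LND.y_notMem_algXST n e m d r Q hn ?_
    rw [← hD, LND.derksenInvariant_eq_top φ]
    trivial
  · rw [LND.omegaB_eq hn hm' hd']
    exact LND.isLeast_liftDegrees hn hm' hd' p
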